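/- Let $K$ be a field of characteristic zero and let $P_i = K[x_1,\dots,x_i]$. For $n\ge 1$ let $$\mathfrak u_n = K\partial_1 + P_1\partial_2 + \cdots + P_{n-1}\partial_n, \qquad \partial_i = \partial/\partial x_i,$$ be the Lie algebra of triangular polynomial derivations of $P_n$. The elements $x^\alpha\partial_i$ ($1\le i\le n$, $\alpha\in\mathbb N^{i-1}$) form a $K$-basis of $\mathfrak u_n$, which is well-ordered by: $x^\alpha\partial_i > x^\beta\partial_j$ if and only if $i<j$, or $i=j$ and there is $k$ with $\alpha_k>\beta_k$ and $\alpha_l=\beta_l$ for all $l>k$. Let $\operatorname{ord}(\alpha,i)$ be the order type of the set of all basis elements $\le x^\alpha\partial_i$. For an ordinal $\lambda$ let $$I_{\lambda,n} = \bigoplus_{\operatorname{ord}(\alpha,i)\le\lambda} K x^\alpha\partial_i ,$$ which is an ideal of $\mathfrak u_n$ (in particular $I_{0,n}=0$). Write $\omega$ for the first infinite ordinal, $\omega^0=1$, and $\omega^k\cdot i$ for the sum $\omega^k+\cdots+\omega^k$ with $i$ summands. Let $2\le n<m$ be natural numbers and let $I$ and $J$ be ideals of $\mathfrak u_n$ and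 $\mathfrak u_m$, respectively. Then the Lie algebras $\mathfrak u_n/I$ and $\mathfrak u_m/J$ are isomorphic over $K$ if and only if $I=I_{\lambda,n}$ and $J=I_{\mu,m}$ for ordinals $\lambda,\mu$ satisfying one of the following conditions: 1. $\lambda=\omega^{n-2}\cdot i+\nu$ and $\mu=\omega^{m-1}+\omega^{m-2}+\cdots+\omega^{n}+\omega^{n-2}\cdot j+\nu$ for some $i,j\in\mathbb N=\{0,1,\dots\}$ and some ordinal $0\le\nu<\omega^{n-2}$; 2. for some $s$ with $2\le s\le n-1$, $\lambda=\omega^{n-1}+\omega^{n-2}+\cdots+\omega^{s}+\omega^{s-2}\cdot i+\nu$ and $\mu=\omega^{m-1}+\omega^{m-2}+\cdots+\omega^{s}+\omega^{s-2}\cdot j+\nu$ for some $i,j\in\mathbb N$ and some ordinal $0\le\nu<\omega^{s-2}$; 3. $\lambda=\omega^{n-1}+\omega^{n-2}+\cdots+\omega+\varepsilon$ and $\mu=\omega^{m-1}+\omega^{m-2}+\cdots+\omega+\varepsilon$ for some $\varepsilon\in\{0,1\}$. -/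

import Mathlib

open MvPolynomial

noncomputable section

namespace TriangularLie

/-! Variables are indexed by `Fin n`, so the index `i : Fin n` stands for the variable
`x_{i+1}`, and the polynomials in the variables of index `< i` form the algebra `P_i`. -/

variable (K : Type*) [Field K] (n : ℕ)

theorem exists_sum_iff (D : Derivation K (MvPolynomial (Fin n) K) (MvPolynomial (Fin n) K)) :
    (∃ p : Fin n → MvPolynomial (Fin n) K,
        (∀ i, p i ∈ supported K {j : Fin n | j < i}) ∧ D = ∑ i, p i • pderiv i) ↔
      ∀ i, D (X i) ∈ supported K {j : Fin n | j < i} := by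
  have key : ∀ (p : Fin n → MvPolynomial (Fin n) K) (i : Fin n),
      (∑ k, p k • pderiv k : Derivation K (MvPolynomial (Fin n) K) _) (X i) = p i := by
    intro p i
    rw [← Derivation.coeFnAddMonoidHom_apply, map_sum, Finset.sum_apply, Finset.sum_eq_single i]
    · simp
    · intro k _ hk
      simp [pderiv_X_of_ne hk.symm]
    · simp
  constructor
  · rintro ⟨p, hp, rfl⟩ i
    rw [key]
    exact hp i
  · intro h
    exact ⟨fun i => D (X i), h, derivation_ext fun i => (key (fun i => D (X i)) i).symm⟩

theorem map_supported {D : Derivation K (MvPolynomial (Fin n) K) (MvPolynomial (Fin n) K)}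
    (hD : ∀ i, D (X i) ∈ supported K {j : Fin n | j < i}) (i : Fin n)
    {f : MvPolynomial (Fin n) K} (hf : f ∈ supported K {j : Fin n | j < i}) :
    D f ∈ supported K {j : Fin n | j < i} := by
  induction hf using Algebra.adjoin_induction with
  | mem x hx =>
    obtain ⟨j, hj, rfl⟩ := hx
    exact supported_mono (fun k (hk : k < j) => lt_trans hk hj) (hD j)
  | algebraMap r => simp
  | add f g _ _ hf hg => rw [map_add]; exact add_mem hf hg
  | mul f g hf' hg' hf hg =>
    rw [Derivation.leibniz, smul_eq_mul, smul_eq_mul]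
    exact add_mem (mul_mem hf' hg) (mul_mem hg' hf)

/-- The Lie algebra `K ∂₁ + P₁ ∂₂ + ⋯ + P_{n-1} ∂_n` of triangular polynomial derivations, as a
Lie subalgebra of the Lie algebra of all `K`-derivations of the polynomial algebra. -/
def triangular :
    LieSubalgebra K (Derivation K (MvPolynomial (Fin n) K) (MvPolynomial (Fin n) K)) where
  carrier := {D | ∃ p : Fin n → MvPolynomial (Fin n) K,
    (∀ i, p i ∈ supported K {j : Fin n | j < i}) ∧ D = ∑ i, p i • pderiv i}
  zero_mem' := (exists_sum_iff K n _).2 fun i => by simp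
  add_mem' {D E} hD hE := (exists_sum_iff K n _).2 fun i => by
    rw [Derivation.add_apply]
    exact add_mem ((exists_sum_iff K n D).1 hD i) ((exists_sum_iff K n E).1 hE i)
  smul_mem' c D hD := (exists_sum_iff K n _).2 fun i => by
    rw [Derivation.smul_apply]
    exact Subalgebra.smul_mem _ ((exists_sum_iff K n D).1 hD i) c
  lie_mem' {D E} hD hE := (exists_sum_iff K n _).2 fun i => by
    have hD := (exists_sum_iff K n D).1 hD
    have hE := (exists_sum_iff K n E).1 hE
    rw [Derivation.commutator_apply]
    exact sub_mem (map_supported K n hD i (hE i)) (map_supported K n hE i (hD i))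

/-- The set of the pairs `(α, i)` with `x^α` a monomial in the variables of index `< i`. It
indexes the canonical basis `x^α ∂_i` of `triangular K n`. -/
structure Index (n : ℕ) where
  i : Fin n
  α : Fin n →₀ ℕ
  α_eq_zero : ∀ j, i ≤ j → α j = 0

/-- The order on the canonical basis: `x^β ∂_j < x^α ∂_i` iff `i < j`, or `i = j` and `β` is
smaller than `α` at the last place where they differ. -/
instance (n : ℕ) : LT (Index n) where
  lt b a := a.i < b.i ∨
    a.i = b.i ∧ ∃ k, b.α k < a.α k ∧ ∀ l, k < l → b.α l = a.α l

/-- An order embedding, from which the order on `Index n` is seen to be a well-order. -/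
def Index.key {n : ℕ} (a : Index n) : (Fin n)ᵒᵈ ×ₗ Colex (Fin n → ℕ) :=
  toLex (OrderDual.toDual a.i, toColex ⇑a.α)

theorem Index.key_lt {n : ℕ} (b a : Index n) : b.key < a.key ↔ b < a := by
  rw [Index.key, Index.key, Prod.Lex.toLex_lt_toLex, OrderDual.toDual_lt_toDual]
  refine or_congr Iff.rfl (and_congr ?_ ?_)
  · rw [OrderDual.toDual_inj, eq_comm]
  · constructor
    · rintro ⟨k, h1, h2⟩
      exact ⟨k, h2, fun l hl => h1 l hl⟩
    · rintro ⟨k, h1, h2⟩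
      exact ⟨k, fun l hl => h2 l hl, h1⟩

theorem Index.key_injective {n : ℕ} : Function.Injective (Index.key (n := n)) := by
  rintro ⟨i, α, h⟩ ⟨j, β, h'⟩ hab
  have h1 : i = j := congrArg (fun z : (Fin n)ᵒᵈ ×ₗ Colex (Fin n → ℕ) => OrderDual.ofDual (ofLex z).1) hab
  have h2 : (α : Fin n → ℕ) = β := congrArg (fun z : (Fin n)ᵒᵈ ×ₗ Colex (Fin n → ℕ) => ofColex (ofLex z).2) hab
  obtain rfl := h1
  obtain rfl := DFunLike.coe_injective h2
  rfl

instance Index.isWellOrder (n : ℕ) : IsWellOrder (Index n) (· < ·) :=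
  have : IsWellOrder ((Fin n)ᵒᵈ ×ₗ Colex (Fin n → ℕ)) (· < ·) :=
    { trichotomous := fun _ _ h1 h2 => le_antisymm (not_lt.1 h2) (not_lt.1 h1)
      wf := (inferInstance : WellFoundedLT ((Fin n)ᵒᵈ ×ₗ Colex (Fin n → ℕ))).wf }
  RelEmbedding.isWellOrder
    (⟨⟨Index.key, Index.key_injective⟩, fun {b a} => Index.key_lt b a⟩ :
      ((· < ·) : Index n → Index n → Prop) ↪r
        ((· < ·) : (Fin n)ᵒᵈ ×ₗ Colex (Fin n → ℕ) → _ → Prop))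

/-- The order type of the set of all the pairs `≤ a`. -/
def Index.ord {n : ℕ} (a : Index n) : Ordinal.{0} :=
  Ordinal.type (Subrel ((· < ·) : Index n → Index n → Prop) fun b => b < a ∨ b = a)

theorem Index.ord_mono {n : ℕ} {b a : Index n} (h : b < a) : b.ord ≤ a.ord := by
  refine Ordinal.type_le_iff'.2 ⟨⟨⟨fun c => ⟨c.1, ?_⟩, ?_⟩, ?_⟩⟩
  · rcases c with ⟨c, hc | rfl⟩
    · exact Or.inl (_root_.trans hc h)
    · exact Or.inl h
  · intro c d hcd
    have h2 := congrArg Subtype.val hcd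
    exact Subtype.ext h2
  · exact Iff.rfl

variable {n}

theorem monomial_mem {α : Fin n →₀ ℕ} {i : Fin n} (h : ∀ j, i ≤ j → α j = 0) (c : K) :
    monomial α c ∈ supported K {j : Fin n | j < i} := by
  rw [mem_supported]
  intro j hj
  obtain ⟨d, hd, hjd⟩ := (mem_vars_iff_mem_support j).1 (Finset.mem_coe.1 hj)
  have hdα : d = α := by simpa using support_monomial_subset hd
  rw [hdα, Finsupp.mem_support_iff] at hjd
  exact not_le.1 fun hij => hjd (h j hij)

/-- The canonical basis element `x^α ∂_i`. -/
def basisElt (a : Index n) : triangular K n :=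
  ⟨(monomial a.α 1 : MvPolynomial (Fin n) K) • pderiv a.i, (exists_sum_iff K n _).2 fun i => by
    rcases eq_or_ne i a.i with rfl | hi
    · rw [Derivation.smul_apply, pderiv_X_self, smul_eq_mul, mul_one]
      exact monomial_mem K a.α_eq_zero 1
    · rw [Derivation.smul_apply, pderiv_X_of_ne hi, smul_zero]
      exact zero_mem _⟩

theorem span_basisElt : Submodule.span K (Set.range (basisElt K (n := n))) = ⊤ := by
  rw [eq_top_iff]
  intro D _
  obtain ⟨p, hp, hD⟩ := D.2
  have hD' : (triangular K n).toSubmodule.subtype D ∈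
      (Submodule.span K (Set.range (basisElt K (n := n)))).map
        (triangular K n).toSubmodule.subtype := by
    change (D : Derivation K (MvPolynomial (Fin n) K) (MvPolynomial (Fin n) K)) ∈ _
    rw [hD]
    refine sum_mem fun i _ => ?_
    rw [(p i).as_sum, Finset.sum_smul]
    refine sum_mem fun d hd => ?_
    have h0 : ∀ j, i ≤ j → d j = 0 := by
      intro j hj
      by_contra hne
      have h1 : j ∈ (p i).vars :=
        (mem_vars_iff_mem_support j).2 ⟨d, hd, Finsupp.mem_support_iff.2 hne⟩
      exact absurd (mem_supported.1 (hp i) h1) (not_lt.2 hj)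
    have h2 : (monomial d (coeff d (p i)) : MvPolynomial (Fin n) K) =
        coeff d (p i) • monomial d 1 := by
      rw [smul_monomial, smul_eq_mul, mul_one]
    rw [h2, smul_assoc]
    exact Submodule.smul_mem _ _
      ⟨basisElt K ⟨i, d, h0⟩, Submodule.subset_span ⟨_, rfl⟩, rfl⟩
  obtain ⟨E, hE, hED⟩ := hD'
  rwa [← Subtype.ext (a1 := E) (a2 := D) hED]

theorem lie_smul_pderiv (f g : MvPolynomial (Fin n) K) (j i : Fin n) :
    ⁅f • (pderiv j : Derivation K (MvPolynomial (Fin n) K) (MvPolynomial (Fin n) K)),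
        g • (pderiv i : Derivation K (MvPolynomial (Fin n) K) (MvPolynomial (Fin n) K))⁆ =
      (f * pderiv j g) • pderiv i - (g * pderiv i f) • pderiv j := by
  classical
  refine derivation_ext fun k => ?_
  have h : ∀ l : Fin n, pderiv l (X k : MvPolynomial (Fin n) K) = C ((Pi.single l 1 : Fin n → K) k) := by
    intro l
    rcases eq_or_ne k l with rfl | hk
    · simp
    · simp [pderiv_X_of_ne hk, hk]
  simp only [Derivation.commutator_apply, Derivation.sub_apply, Derivation.smul_apply, h,
    smul_eq_mul, Derivation.leibniz, pderiv_C, mul_zero, zero_add]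
  ring

theorem lie_basisElt_of_lt (b a : Index n) (h : b.i < a.i) :
    ⁅basisElt K b, basisElt K a⁆ = 0 ∨
      ∃ c : Index n, ∃ r : K, c.i = a.i ∧ c < a ∧
        ⁅basisElt K b, basisElt K a⁆ = r • basisElt K c := by
  have h1 : (⁅basisElt K b, basisElt K a⁆ : triangular K n).1 =
      (monomial (b.α + (a.α - Finsupp.single b.i 1)) (a.α b.i : K)) • pderiv a.i := by
    change ⁅(monomial b.α 1 : MvPolynomial (Fin n) K) • pderiv b.i,
      (monomial a.α 1 : MvPolynomial (Fin n) K) • pderiv a.i⁆ = _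
    rw [lie_smul_pderiv, pderiv_monomial, pderiv_monomial, b.α_eq_zero _ h.le]
    simp [monomial_mul]
  by_cases h0 : a.α b.i = 0
  · left
    apply Subtype.ext
    rw [h1, h0]
    simp
  · right
    refine ⟨⟨a.i, b.α + (a.α - Finsupp.single b.i 1), ?_⟩, (a.α b.i : K), rfl,
      Or.inr ⟨rfl, b.i, ?_, ?_⟩, ?_⟩
    · intro j hj
      simp [b.α_eq_zero j (h.le.trans hj), a.α_eq_zero j hj]
    · simp only [Finsupp.coe_add, Finsupp.coe_tsub, Pi.add_apply, Pi.sub_apply,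
        Finsupp.single_eq_same, b.α_eq_zero b.i le_rfl]
      omega
    · intro l hl
      simp [b.α_eq_zero l hl.le, Finsupp.single_eq_of_ne hl.ne']
    · apply Subtype.ext
      rw [h1]
      change _ = (a.α b.i : K) • (monomial _ (1 : K) • pderiv a.i)
      rw [← smul_assoc, smul_monomial, smul_eq_mul, mul_one]

theorem lie_basisElt (b a : Index n) :
    ⁅basisElt K b, basisElt K a⁆ = 0 ∨
      ∃ c : Index n, ∃ r : K, c < a ∧ ⁅basisElt K b, basisElt K a⁆ = r • basisElt K c := by
  rcases lt_trichotomy b.i a.i with h | h | h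
  · rcases lie_basisElt_of_lt K b a h with h | ⟨c, r, -, hc, h⟩
    · exact Or.inl h
    · exact Or.inr ⟨c, r, hc, h⟩
  · left
    apply Subtype.ext
    change ⁅(monomial b.α 1 : MvPolynomial (Fin n) K) • pderiv b.i,
      (monomial a.α 1 : MvPolynomial (Fin n) K) • pderiv a.i⁆ = 0
    rw [lie_smul_pderiv, pderiv_monomial, pderiv_monomial, a.α_eq_zero _ h.ge,
      b.α_eq_zero _ h.le]
    simp
  · rcases lie_basisElt_of_lt K a b h with h' | ⟨c, r, hi, -, h'⟩
    · left
      rw [← lie_skew, h', neg_zero]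
    · refine Or.inr ⟨c, -r, Or.inl (hi ▸ h), ?_⟩
      rw [← lie_skew, h', neg_smul]

/-- The ideal `I_λ`: the span of the canonical basis elements `x^α ∂_i` with `ord (α, i) ≤ λ`. -/
def idealOf (n : ℕ) (l : Ordinal.{0}) : LieIdeal K (triangular K n) where
  __ := Submodule.span K (basisElt K '' {a : Index n | a.ord ≤ l})
  lie_mem {D E} hE := by
    change E ∈ Submodule.span K (basisElt K '' {a : Index n | a.ord ≤ l}) at hE
    change ⁅D, E⁆ ∈ Submodule.span K (basisElt K '' {a : Index n | a.ord ≤ l})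
    have hD : D ∈ Submodule.span K (Set.range (basisElt K (n := n))) := by
      rw [span_basisElt]
      trivial
    induction hD using Submodule.span_induction with
    | zero => rw [zero_lie]; exact zero_mem _
    | add x y _ _ hx hy => rw [add_lie]; exact add_mem hx hy
    | smul c x _ hx => rw [smul_lie]; exact Submodule.smul_mem _ c hx
    | mem x hx =>
      obtain ⟨b, rfl⟩ := hx
      induction hE using Submodule.span_induction with
      | zero => rw [lie_zero]; exact zero_mem _
      | add x y _ _ hx hy => rw [lie_add]; exact add_mem hx hy
      | smul c x _ hx => rw [lie_smul]; exact Submodule.smul_mem _ c hx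
      | mem x hx =>
        obtain ⟨a, ha, rfl⟩ := hx
        rcases lie_basisElt K b a with h | ⟨c, r, hc, h⟩
        · rw [h]; exact zero_mem _
        · rw [h]
          exact Submodule.smul_mem _ r
            (Submodule.subset_span ⟨c, (Index.ord_mono hc).trans ha, rfl⟩)

/-- The ordinal `ω^(n-1) + ω^(n-2) + ⋯ + ω^s` (equal to `0` when `n ≤ s`). -/
def omegaSum (s : ℕ) : ℕ → Ordinal.{0}
  | 0 => 0
  | n + 1 => if s ≤ n then Ordinal.omega0 ^ n + omegaSum s n else 0

end TriangularLie

end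

noncomputable section

namespace TriangularLie

open Ordinal

/-! ### Positions of basis elements -/

/-! The canonical basis is well-ordered of type ω^(n-1) + ⋯ + ω + 1: the layer of ∂_i is a block of
type ω^(i-1), and the exponents give base-ω digits inside it. `Index.pos` makes this explicit. In
characteristic zero, brackets lower leading terms gradually enough that an ideal containing an
element with leading term a contains every basis element up to a (`IsLeading.basisElt_mem`). Hence
the ideals are exactly the chain I_λ (`exists_eq_idealOf`).

Isomorphisms come from two kinds of surjections that shift this chain. Restriction to the first s
variables (`restrict`) pulls I_ν back to I_(δ+ν) with δ = ω^(n-1) + ⋯ + ω^s. On the algebra in s + 2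
variables, differentiating the last component by the second last variable (`diffLast`) commutes with
brackets and shifts by ω^s. So every factor is isomorphic to some 𝔲_t/I_ν with ν < ω^(t-2), where ν
= 0 if t < 2 (`exists_normal_form`, `nonempty_equiv`).

The pair (t, ν) is an invariant (`eq_and_eq_of_equiv`). The ideals of a factor form a well-ordered
chain, whose embedding as an initial segment of the ordinals is unique, so an isomorphism preserves
the position of each ideal (`exists_comap_eq`). The length of the chain gives t. With s = t - 2, the
bracket of the ideals I_(ω^(s+1)+ν) and I_(ω^s+1) lies in I_ν, and this vanishing in the factor
detects ν (`le_of_surjective`). The three conditions are the cases t = n, 2 ≤ t < n and t ≤ 1 of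
equal pairs. -/

/-- The ordinal `ω^(k-1) c_(k-1) + ⋯ + ω c_1 + c_0`. -/
def digits : ℕ → (ℕ → ℕ) → Ordinal.{0}
  | 0, _ => 0
  | k + 1, c => ω ^ k * c k + digits k c

theorem digits_congr {k : ℕ} {b c : ℕ → ℕ} (h : ∀ j < k, b j = c j) : digits k b = digits k c := by
  induction k with
  | zero => rfl
  | succ k ih =>
    rw [digits, digits, h k k.lt_succ_self, ih fun j hj => h j (hj.trans k.lt_succ_self)]

theorem mul_natCast_add_lt {a r : Ordinal.{0}} {c d : ℕ} (hr : r < a) (h : c < d) :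
    a * c + r < a * d := by
  calc a * c + r < a * c + a := by gcongr
    _ = a * (c + 1 : ℕ) := by rw [Nat.cast_succ, mul_add_one]
    _ ≤ a * d := by gcongr; exact h

theorem opow_mul_add_lt {k c : ℕ} {r : Ordinal.{0}} (hr : r < ω ^ k) :
    ω ^ k * c + r < ω ^ (k + 1) := by
  refine (mul_natCast_add_lt hr c.lt_succ_self).trans ?_
  rw [pow_succ]
  have : (0 : Ordinal.{0}) < ω ^ k := pow_pos omega0_pos _
  exact (mul_lt_mul_iff_right₀ this).2 (natCast_lt_omega0 _)

theorem digits_lt (k : ℕ) (c : ℕ → ℕ) : digits k c < ω ^ k := by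
  induction k with
  | zero => simp [digits]
  | succ k ih => exact opow_mul_add_lt ih

/-- The top differing digit outweighs all digits below it, by `digits_lt`; colexicographic
comparison of exponents thus becomes comparison of ordinals. -/
theorem digits_lt_digits {k j : ℕ} {b c : ℕ → ℕ} (hj : j < k) (h : b j < c j)
    (h' : ∀ l, j < l → l < k → b l = c l) : digits k b < digits k c := by
  induction k with
  | zero => omega
  | succ k ih =>
    rw [digits, digits]
    rcases (Nat.lt_succ_iff.1 hj).eq_or_lt with rfl | hjk
    · exact (mul_natCast_add_lt (digits_lt j b) h).trans_le le_self_add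
    · rw [h' k hjk k.lt_succ_self]
      gcongr
      exact ih hjk fun l hl hlk => h' l hl (hlk.trans k.lt_succ_self)

theorem exists_eq_opow_mul_add {k : ℕ} {r : Ordinal.{0}} (hr : r < ω ^ (k + 1)) :
    ∃ (c : ℕ) (r' : Ordinal.{0}), r' < ω ^ k ∧ r = ω ^ k * c + r' := by
  have h0 : (ω ^ k : Ordinal.{0}) ≠ 0 := (pow_pos omega0_pos _).ne'
  rw [pow_succ] at hr
  obtain ⟨c, hc⟩ := lt_omega0.1 ((Ordinal.lt_mul_iff_div_lt h0).1 hr)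
  exact ⟨c, r % ω ^ k, mod_lt _ h0, by rw [← hc, div_add_mod]⟩

theorem exists_digits_eq {k : ℕ} {r : Ordinal.{0}} (hr : r < ω ^ k) : ∃ c, digits k c = r := by
  induction k generalizing r with
  | zero => exact ⟨0, by simpa [digits, eq_comm] using hr⟩
  | succ k ih =>
    obtain ⟨c, r', hr', rfl⟩ := exists_eq_opow_mul_add hr
    obtain ⟨d, rfl⟩ := ih hr'
    refine ⟨fun j => if j = k then c else d j, ?_⟩
    rw [digits, if_pos rfl, digits_congr fun j hj => if_neg hj.ne]

/-! ### Sums of descending powers of ω -/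

theorem omegaSum_eq_zero {s n : ℕ} (h : n ≤ s) : omegaSum s n = 0 := by
  cases n with
  | zero => rfl
  | succ n => rw [omegaSum, if_neg (by omega)]

theorem omegaSum_add {r s n : ℕ} (hrs : r ≤ s) (hsn : s ≤ n) :
    omegaSum s n + omegaSum r s = omegaSum r n := by
  induction n, hsn using Nat.le_induction with
  | base => rw [omegaSum_eq_zero le_rfl, zero_add]
  | succ n hsn ih => rw [omegaSum, omegaSum, if_pos hsn, if_pos (hrs.trans hsn), add_assoc, ih]

theorem omegaSum_self_succ (s : ℕ) : omegaSum s (s + 1) = ω ^ s := by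
  rw [omegaSum, if_pos le_rfl, omegaSum_eq_zero le_rfl, add_zero]

theorem omegaSum_succ_add {s n : ℕ} (h : s < n) : omegaSum (s + 1) n + ω ^ s = omegaSum s n := by
  rw [← omegaSum_self_succ, omegaSum_add s.le_succ h]

theorem omegaSum_anti {r s : ℕ} (h : r ≤ s) (n : ℕ) : omegaSum s n ≤ omegaSum r n := by
  rcases le_total s n with hs | hs
  · rw [← omegaSum_add h hs]
    exact le_self_add
  · rw [omegaSum_eq_zero hs]
    exact zero_le

/-- Blocks run from layer n - 1 down to layer 0; here s is the layer whose block contains o, and r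
is the offset inside the block. -/
theorem exists_eq_omegaSum_add {n : ℕ} {o : Ordinal.{0}} (h : o < omegaSum 0 n) :
    ∃ s < n, ∃ r < ω ^ s, o = omegaSum (s + 1) n + r := by
  classical
  -- The least such t is the start of the block. It is nonzero by `h`, and minimality at s = t - 1
  -- bounds the offset.
  have hex : ∃ t, omegaSum t n ≤ o := ⟨n, by rw [omegaSum_eq_zero le_rfl]; exact zero_le⟩
  obtain ⟨s, hs⟩ : ∃ s, Nat.find hex = s + 1 :=
    Nat.exists_eq_succ_of_ne_zero fun h0 => absurd (Nat.find_spec hex) (by rw [h0]; exact not_le.2 h)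
  have h1 := Nat.find_spec hex
  have h2 := not_le.1 (Nat.find_min hex (m := s) (by omega))
  rw [hs] at h1
  have hsn : s < n := by
    by_contra hsn
    rw [omegaSum_eq_zero (not_lt.1 hsn)] at h2
    exact absurd h2 (not_lt.2 zero_le)
  refine ⟨s, hsn, o - omegaSum (s + 1) n, ?_, (Ordinal.add_sub_cancel_of_le h1).symm⟩
  rwa [← add_lt_add_iff_left (omegaSum (s + 1) n), Ordinal.add_sub_cancel_of_le h1, omegaSum_succ_add hsn]

/-- The exponents of a basis element, extended by zero. -/
def Index.digit {n : ℕ} (a : Index n) (j : ℕ) : ℕ := if h : j < n then a.α ⟨j, h⟩ else 0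

theorem Index.digit_val {n : ℕ} (a : Index n) (j : Fin n) : a.digit j = a.α j := by
  simp [Index.digit]

/-- The order type of the set of the basis elements below `a`. -/
def Index.pos {n : ℕ} (a : Index n) : Ordinal.{0} := omegaSum (a.i + 1) n + digits a.i a.digit

theorem Index.pos_lt_omegaSum {n : ℕ} (a : Index n) : a.pos < omegaSum a.i n := by
  rw [Index.pos, ← omegaSum_succ_add a.i.2]
  gcongr
  exact digits_lt _ _

theorem Index.pos_lt_top {n : ℕ} (a : Index n) : a.pos < omegaSum 0 n :=
  a.pos_lt_omegaSum.trans_le (omegaSum_anti (Nat.zero_le _) n)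

theorem Index.pos_lt_pos {n : ℕ} {a b : Index n} (h : b < a) : b.pos < a.pos := by
  rcases h with h | ⟨h, k, hk, hl⟩
  · exact b.pos_lt_omegaSum.trans_le ((omegaSum_anti (Nat.succ_le_of_lt h) n).trans le_self_add)
  · rw [Index.pos, Index.pos, h]
    gcongr
    have hki : k < b.i := by
      by_contra hki
      rw [a.α_eq_zero k (h ▸ not_lt.1 hki)] at hk
      omega
    refine digits_lt_digits (j := k) hki (by simpa only [Index.digit_val] using hk) fun l hkl hlb => ?_
    have := hl ⟨l, hlb.trans b.i.2⟩ hkl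
    simpa [Index.digit, hlb.trans b.i.2] using this

theorem Index.pos_lt_pos_iff {n : ℕ} {a b : Index n} : b.pos < a.pos ↔ b < a := by
  refine ⟨fun h => ?_, Index.pos_lt_pos⟩
  rcases trichotomous_of (α := Index n) (· < ·) b a with h' | rfl | h'
  · exact h'
  · exact absurd h (lt_irrefl _)
  · exact absurd h (Index.pos_lt_pos h').not_gt

theorem Index.pos_injective {n : ℕ} : Function.Injective (Index.pos (n := n)) := by
  intro a b h
  rcases trichotomous_of (α := Index n) (· < ·) a b with h' | h' | h'
  · exact absurd h (Index.pos_lt_pos h').ne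
  · exact h'
  · exact absurd h (Index.pos_lt_pos h').ne'

theorem Index.exists_pos_eq {n : ℕ} {i : Fin n} {r : Ordinal.{0}} (hr : r < ω ^ (i : ℕ)) :
    ∃ a : Index n, a.i = i ∧ a.pos = omegaSum (i + 1) n + r := by
  obtain ⟨c, rfl⟩ := exists_digits_eq hr
  refine ⟨⟨i, Finsupp.equivFunOnFinite.symm fun j => if j < i then c j else 0, fun j hj => by
    simp [not_lt.2 hj]⟩, rfl, ?_⟩
  rw [Index.pos]
  congr 1
  refine digits_congr fun j hj => ?_
  have hj' : (⟨j, hj.trans i.2⟩ : Fin n) < i := hj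
  simp [Index.digit, hj.trans i.2, hj']

theorem Index.exists_pos_eq_of_lt {n : ℕ} {o : Ordinal.{0}} (h : o < omegaSum 0 n) :
    ∃ a : Index n, a.pos = o := by
  obtain ⟨s, hs, r, hr, rfl⟩ := exists_eq_omegaSum_add h
  obtain ⟨a, -, ha⟩ := Index.exists_pos_eq (i := ⟨s, hs⟩) hr
  exact ⟨a, ha⟩

/-- `Index.pos` maps the elements ≤ a isomorphically onto the ordinals ≤ `a.pos`. The order type
counts a itself, hence the `+ 1`. -/
theorem Index.ord_eq {n : ℕ} (a : Index n) : a.ord = a.pos + 1 := by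
  have e : Subrel ((· < ·) : Index n → Index n → Prop) (fun b => b < a ∨ b = a) ≃r
      ((· < ·) : Set.Iio (a.pos + 1) → Set.Iio (a.pos + 1) → Prop) := by
    have hmem : ∀ b : {b : Index n // b < a ∨ b = a}, b.1.pos < a.pos + 1 := by
      rintro ⟨b, hb | rfl⟩
      · exact (Index.pos_lt_pos hb).trans (lt_add_one _)
      · exact lt_add_one _
    refine ⟨Equiv.ofBijective (fun b => ⟨b.1.pos, hmem b⟩) ⟨?_, ?_⟩, ?_⟩
    · intro b c hbc
      exact Subtype.ext (Index.pos_injective (congrArg Subtype.val hbc))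
    · rintro ⟨o, ho⟩
      have ho' : o ≤ a.pos := Order.lt_add_one_iff.1 ho
      obtain ⟨b, rfl⟩ := Index.exists_pos_eq_of_lt (ho'.trans_lt a.pos_lt_top)
      refine ⟨⟨b, ?_⟩, rfl⟩
      rcases ho'.lt_or_eq with h | h
      · exact Or.inl (Index.pos_lt_pos_iff.1 h)
      · exact Or.inr (Index.pos_injective h)
    · intro b c
      exact Index.pos_lt_pos_iff
  have h := e.ordinal_lift_type_eq
  rw [type_Iio_lt, typein_ordinal, lift_id'] at h
  exact Ordinal.lift_inj.1 h

end TriangularLie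

namespace TriangularLie

variable (K : Type*) [Field K] {n : ℕ}

/-! ### Coordinates -/

/-- The coordinate at a basis element. -/
def coord (a : Index n) : triangular K n →ₗ[K] K where
  toFun D := coeff a.α (D.1 (X a.i))
  map_add' D E := by simp
  map_smul' c D := by simp

theorem coord_apply (a : Index n) (D : triangular K n) : coord K a D = coeff a.α (D.1 (X a.i)) := rfl

theorem coord_basisElt [DecidableEq (Index n)] (a b : Index n) :
    coord K a (basisElt K b) = if a = b then 1 else 0 := by
  classical
  rw [coord_apply]
  change coeff a.α ((monomial b.α (1 : K) • pderiv b.i) (X a.i)) = _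
  rw [Derivation.smul_apply, smul_eq_mul]
  split_ifs with h
  · subst h
    simp
  · by_cases hi : a.i = b.i
    · rw [hi, pderiv_X_self, mul_one, coeff_monomial, if_neg]
      intro hα
      obtain ⟨i, α, hα'⟩ := a
      obtain ⟨j, β, hβ⟩ := b
      exact h (by obtain rfl : i = j := hi; obtain rfl : β = α := hα; rfl)
    · rw [pderiv_X_of_ne hi, mul_zero, coeff_zero]

theorem mem_supported_apply_X (D : triangular K n) (i : Fin n) :
    D.1 (X i) ∈ supported K {j : Fin n | j < i} :=
  (exists_sum_iff K n D.1).1 D.2 i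

theorem linearIndependent_basisElt : LinearIndependent K (basisElt K (n := n)) := by
  classical
  rw [linearIndependent_iff]
  intro l hl
  ext a
  have h := congrArg (coord K a) hl
  rw [map_zero, Finsupp.linearCombination_apply, Finsupp.sum, map_sum] at h
  simpa [coord_basisElt] using h

/-- The canonical basis. -/
def basis (n : ℕ) : Module.Basis (Index n) K (triangular K n) :=
  .mk (linearIndependent_basisElt K) (span_basisElt K).ge

theorem basis_apply (a : Index n) : basis K n a = basisElt K a := Module.Basis.mk_apply ..

theorem basis_repr (D : triangular K n) (a : Index n) : (basis K n).repr D a = coord K a D := by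
  classical
  have : (basis K n).coord a = coord K a := (basis K n).ext fun b => by
    rw [Module.Basis.coord_apply, Module.Basis.repr_self, basis_apply, coord_basisElt,
      Finsupp.single_apply]
    simp only [eq_comm]
  exact LinearMap.congr_fun this D

variable {K}

theorem ext_coord {D E : triangular K n} (h : ∀ a, coord K a D = coord K a E) : D = E :=
  (basis K n).repr.injective (Finsupp.ext fun a => by simp only [basis_repr, h])

theorem mem_span_basisElt {S : Set (Index n)} {D : triangular K n} :
    D ∈ Submodule.span K (basisElt K '' S) ↔ ∀ a, coord K a D ≠ 0 → a ∈ S := by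
  have : (basisElt K (n := n)) = basis K n := funext fun a => (basis_apply K a).symm
  rw [this, Module.Basis.mem_span_image]
  simp [Set.subset_def, basis_repr]

/-- As `ord` is `pos + 1`, the condition ord ≤ l means pos < l: positions start at 0 and l is the
first one excluded. -/
theorem mem_idealOf {l : Ordinal.{0}} {D : triangular K n} :
    D ∈ idealOf K n l ↔ ∀ a, l ≤ a.pos → coord K a D = 0 := by
  change D ∈ Submodule.span K (basisElt K '' {a : Index n | a.ord ≤ l}) ↔ _
  rw [mem_span_basisElt]
  refine forall_congr' fun a => ?_
  rw [Set.mem_ofPred_eq, Index.ord_eq, ← not_imp_not, not_ne_iff, Order.add_one_le_iff, not_lt]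

theorem basisElt_mem_idealOf {l : Ordinal.{0}} {a : Index n} :
    basisElt K a ∈ idealOf K n l ↔ a.pos < l := by
  classical
  rw [mem_idealOf]
  simp only [coord_basisElt]
  constructor
  · intro h
    by_contra h'
    simpa using h a (not_lt.1 h')
  · intro h b hb
    rw [if_neg]
    rintro rfl
    exact absurd h (not_lt.2 hb)

theorem idealOf_mono {l l' : Ordinal.{0}} (h : l ≤ l') : idealOf K n l ≤ idealOf K n l' := by
  intro D hD
  rw [mem_idealOf] at hD ⊢
  exact fun a ha => hD a (h.trans ha)

/-- The bound on l is needed because all ordinals from `omegaSum 0 n` on give the whole algebra. -/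
theorem idealOf_le_iff {l l' : Ordinal.{0}} (h : l ≤ omegaSum 0 n) :
    idealOf K n l ≤ idealOf K n l' ↔ l ≤ l' := by
  refine ⟨fun hle => ?_, idealOf_mono⟩
  by_contra hlt
  obtain ⟨a, rfl⟩ := Index.exists_pos_eq_of_lt ((not_le.1 hlt).trans_le h)
  exact lt_irrefl _ (basisElt_mem_idealOf.1 (hle (basisElt_mem_idealOf.2 (not_le.1 hlt))))

theorem idealOf_lt_iff {l l' : Ordinal.{0}} (h : l ≤ omegaSum 0 n) (h' : l' ≤ omegaSum 0 n) :
    idealOf K n l < idealOf K n l' ↔ l < l' := by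
  rw [lt_iff_le_not_ge, lt_iff_le_not_ge, idealOf_le_iff h, idealOf_le_iff h']

theorem idealOf_inj {l l' : Ordinal.{0}} (h : l ≤ omegaSum 0 n) (h' : l' ≤ omegaSum 0 n) :
    idealOf K n l = idealOf K n l' ↔ l = l' := by
  rw [le_antisymm_iff, le_antisymm_iff, idealOf_le_iff h, idealOf_le_iff h']

/-! ### Every ideal is one of the ideals `I_λ` -/

/-- `a` is the greatest basis element that occurs in `D`. -/
structure IsLeading (a : Index n) (D : triangular K n) : Prop where
  ne_zero : coord K a D ≠ 0
  eq_zero : ∀ b, a < b → coord K b D = 0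

theorem exists_isLeading {D : triangular K n} (hD : D ≠ 0) : ∃ a, IsLeading a D := by
  have hne : ((basis K n).repr D).support.Nonempty := by
    rw [Finsupp.support_nonempty_iff]
    exact fun h => hD ((basis K n).repr.map_eq_zero_iff.1 h)
  obtain ⟨a, ha, hmax⟩ := Finset.exists_max_image _ Index.pos hne
  refine ⟨a, by simpa [basis_repr] using ha, fun b hb => ?_⟩
  by_contra hb'
  exact absurd (Index.pos_lt_pos hb) (not_lt.2 (hmax b (by simpa [basis_repr] using hb')))

theorem coord_eq_zero_of_X {D : triangular K n} {a : Index n} (h : D.1 (X a.i) = 0) :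
    coord K a D = 0 := by rw [coord_apply, h, coeff_zero]

theorem lie_apply_X (D E : triangular K n) (k : Fin n) :
    (⁅D, E⁆ : triangular K n).1 (X k) = D.1 (E.1 (X k)) - E.1 (D.1 (X k)) := by
  rw [LieSubalgebra.coe_bracket, Derivation.commutator_apply]

theorem basisElt_apply_X_self (b : Index n) : (basisElt K b).1 (X b.i) = monomial b.α 1 := by
  change (monomial b.α (1 : K) • pderiv b.i) (X b.i) = _
  rw [Derivation.smul_apply, pderiv_X_self, smul_eq_mul, mul_one]

theorem basisElt_apply_X_of_ne (b : Index n) {k : Fin n} (h : k ≠ b.i) :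
    (basisElt K b).1 (X k) = 0 := by
  change (monomial b.α (1 : K) • pderiv b.i) (X k) = _
  rw [Derivation.smul_apply, pderiv_X_of_ne h, smul_zero]

theorem basisElt_apply (b : Index n) (f : MvPolynomial (Fin n) K) :
    (basisElt K b).1 f = monomial b.α 1 * pderiv b.i f := rfl

theorem IsLeading.apply_X_eq_zero {D : triangular K n} {a : Index n} (h : IsLeading a D) {j : Fin n}
    (hj : j < a.i) : D.1 (X j) = 0 := by
  classical
  by_contra hne
  obtain ⟨d, hd⟩ := ne_zero_iff.1 hne
  refine hd (h.eq_zero ⟨j, d, fun k hk => ?_⟩ (Or.inl hj))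
  by_contra hdk
  have := mem_supported.1 (mem_supported_apply_X K D j)
    (Finset.mem_coe.2 ((mem_vars_iff_mem_support k).2 ⟨d, mem_support_iff.2 hd, Finsupp.mem_support_iff.2 hdk⟩))
  exact absurd this (not_lt.2 hk)

theorem apply_eq_zero_of_mem_supported {D : triangular K n} {i : Fin n}
    (h : ∀ j < i, D.1 (X j) = 0) {f : MvPolynomial (Fin n) K}
    (hf : f ∈ supported K {j : Fin n | j < i}) : D.1 f = 0 :=
  derivation_eqOn_supported (D₁ := D.1) (D₂ := 0) (fun j hj => h j hj) hf

/-- Let k be the last place where a and b differ. Bracketing with x^γ ∂_k lowers the exponent of a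
at k by one, leaves those above k, and adds the exponents of b below k. The result is below a but
not below b. -/
theorem IsLeading.exists_lie_same {D : triangular K n} {a b : Index n} [CharZero K]
    (h : IsLeading a D) (hba : b < a) (hi : a.i = b.i) :
    ∃ (a' : Index n) (E : triangular K n), b.pos ≤ a'.pos ∧ a' < a ∧ IsLeading a' ⁅E, D⁆ := by
  classical
  obtain ⟨k, hk, hl⟩ : ∃ k, b.α k < a.α k ∧ ∀ l, k < l → b.α l = a.α l := by
    rcases hba with hba | ⟨-, hba⟩
    · exact absurd hi hba.ne
    · exact hba
  have hki : k < a.i := by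
    by_contra hki
    rw [a.α_eq_zero k (not_lt.1 hki)] at hk
    omega
  set γ : Fin n →₀ ℕ := b.α.filter (· < k) with hγ
  have hγ1 : ∀ l, l < k → γ l = b.α l := fun l hlk => Finsupp.filter_apply_pos _ _ hlk
  have hγ2 : ∀ l, k ≤ l → γ l = 0 := fun l hlk => Finsupp.filter_apply_neg _ _ (not_lt.2 hlk)
  set e : Index n := ⟨k, γ, hγ2⟩ with he
  set α' : Fin n →₀ ℕ := a.α - Finsupp.single k 1 + γ with hα'
  have hα1 : ∀ l, l < k → α' l = a.α l + b.α l := fun l hlk => by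
    simp [hα', hγ1 l hlk, Finsupp.single_eq_of_ne hlk.ne]
  have hα2 : α' k = a.α k - 1 := by simp [hα', hγ2 k le_rfl]
  have hα3 : ∀ l, k < l → α' l = a.α l := fun l hlk => by
    simp [hα', hγ2 l hlk.le, Finsupp.single_eq_of_ne hlk.ne']
  have hX : ∀ j, j ≤ a.i → (⁅basisElt K e, D⁆ : triangular K n).1 (X j) =
      monomial γ 1 * pderiv k (D.1 (X j)) := by
    intro j hj
    rw [lie_apply_X, basisElt_apply]
    rcases eq_or_ne j k with rfl | hjk
    · have h2 := basisElt_apply_X_self (K := K) e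
      have h3 : D.1 (monomial e.α 1) = 0 :=
        apply_eq_zero_of_mem_supported (i := a.i) (fun l hl => h.apply_X_eq_zero hl)
          (monomial_mem K (fun l hl => hγ2 l (hki.le.trans hl)) 1)
      rw [h2, h3, sub_zero]
    · rw [basisElt_apply_X_of_ne e hjk, map_zero, sub_zero]
  have hcoord : ∀ d : Index n, d.i = a.i → coord K d ⁅basisElt K e, D⁆ =
      if γ ≤ d.α then coeff (d.α - γ + Finsupp.single k 1) (D.1 (X a.i)) * (d.α k + 1 : K) else 0 := by
    intro d hd
    rw [coord_apply, hX _ hd.le, hd, coeff_monomial_mul', coeff_pderiv]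
    simp [hγ2 k le_rfl]
  refine ⟨⟨a.i, α', fun j hj => by rw [hα3 j (hki.trans_le hj), a.α_eq_zero j hj]⟩, basisElt K e, ?_, ?_, ?_, ?_⟩
  · rw [← not_lt, Index.pos_lt_pos_iff]
    rintro (hlt | ⟨-, p, hp1, hp2⟩)
    · exact absurd hi hlt.ne'
    · simp only at hp1
      rcases lt_trichotomy p k with hpk | rfl | hpk
      · rw [hα1 p hpk] at hp1
        omega
      · omega
      · rw [hα3 p hpk, hl p hpk] at hp1
        exact lt_irrefl _ hp1
  · exact Or.inr ⟨rfl, k, by simp only [hα2]; omega, hα3⟩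
  · rw [hcoord ⟨a.i, α', _⟩ rfl, if_pos (by simp [hα'])]
    refine mul_ne_zero ?_ (Nat.cast_add_one_ne_zero _)
    have : α' - γ + Finsupp.single k 1 = a.α := by
      ext l
      rcases lt_trichotomy l k with hlk | rfl | hlk
      · simp [hα1 l hlk, hγ1 l hlk, Finsupp.single_eq_of_ne hlk.ne]
      · simp [hα2, hγ2 l le_rfl]; omega
      · simp [hα3 l hlk, hγ2 l hlk.le, Finsupp.single_eq_of_ne hlk.ne']
    simp only [this]
    exact h.ne_zero
  · rintro d (hd | ⟨hd, p, hp1, hp2⟩)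
    · apply coord_eq_zero_of_X
      rw [hX _ (le_of_lt hd), h.apply_X_eq_zero hd, map_zero, mul_zero]
    · rw [hcoord d hd]
      split_ifs with hle
      · refine mul_eq_zero_of_left ?_ _
        -- The monomial of D that contributes to d compares with a as d compares with α'. So if d
        -- lies above α', that monomial lies above a and is absent from D.
        have key : ∀ l, (d.α - γ + Finsupp.single k 1 : Fin n →₀ ℕ) l + α' l = a.α l + d.α l := by
          intro l
          have := hle l
          rcases lt_trichotomy l k with hlk | rfl | hlk
          · simp [hα1 l hlk, hγ1 l hlk, Finsupp.single_eq_of_ne hlk.ne]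
            rw [hγ1 l hlk] at this
            omega
          · simp [hα2, hγ2 l le_rfl]; omega
          · simp [hα3 l hlk, hγ2 l hlk.le, Finsupp.single_eq_of_ne hlk.ne']
            omega
        have hsupp : ∀ l, a.i ≤ l → (d.α - γ + Finsupp.single k 1 : Fin n →₀ ℕ) l = 0 := fun l hl' => by
          simp [d.α_eq_zero l (hd ▸ hl'), Finsupp.single_eq_of_ne (hki.trans_le hl').ne']
        refine h.eq_zero ⟨a.i, _, hsupp⟩ (Or.inr ⟨rfl, p, ?_, fun l hpl => ?_⟩)
        · have := key p
          simp only at hp1 ⊢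
          omega
        · have := key l
          have := hp2 l hpl
          simp only at this ⊢
          omega
      · rfl

/-- When D starts with a multiple of ∂_i, its bracket with x_i^(N+1) ∂_(i+1) has leading term a
multiple of x_i^N ∂_(i+1). Such terms are cofinal in the next layer, and every layer after that lies
below them. -/
theorem IsLeading.exists_lie_later {D : triangular K n} {a b : Index n} [CharZero K]
    (h : IsLeading a D) (ha : a.α = 0) (hab : a.i < b.i) :
    ∃ (a' : Index n) (E : triangular K n), b.pos ≤ a'.pos ∧ a' < a ∧ IsLeading a' ⁅E, D⁆ := by
  classical
  have hDi : D.1 (X a.i) = C (coord K a D) := by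
    ext d
    rw [coeff_C]
    split_ifs with hd
    · rw [coord_apply, ha, hd]
    · by_contra hne
      have hsupp : ∀ j, a.i ≤ j → d j = 0 := by
        intro j hj
        by_contra hdj
        have := mem_supported.1 (mem_supported_apply_X K D a.i) (Finset.mem_coe.2
          ((mem_vars_iff_mem_support j).2 ⟨d, mem_support_iff.2 hne, Finsupp.mem_support_iff.2 hdj⟩))
        exact absurd this (not_lt.2 hj)
      refine hne (h.eq_zero ⟨a.i, d, hsupp⟩ ?_)
      rw [← Index.pos_lt_pos_iff, ← not_le, le_iff_lt_or_eq, Index.pos_lt_pos_iff,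
        Index.pos_injective.eq_iff]
      rintro ((hlt | ⟨-, p, hp, -⟩) | heq)
      · exact absurd hlt (lt_irrefl _)
      · simp [ha] at hp
      · exact hd (by rw [← heq] at ha; exact ha.symm)
  set j : Fin n := ⟨a.i + 1, lt_of_le_of_lt (Nat.succ_le_of_lt hab) b.i.2⟩ with hj
  have hij : a.i < j := Nat.lt_succ_self _
  -- The variable of index `a.i` is the highest one allowed in the next layer, so an exponent
  -- exceeding that of b there suffices, whatever the lower exponents of b are.
  set N := b.α a.i + 1 with hN
  have hs : ∀ (M : ℕ) (l : Fin n), j ≤ l → Finsupp.single a.i M l = 0 := fun M l hl =>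
    Finsupp.single_eq_of_ne (hij.trans_le hl).ne'
  set e : Index n := ⟨j, Finsupp.single a.i (N + 1), hs _⟩ with he
  have hlow : ∀ l < j, (⁅-basisElt K e, D⁆ : triangular K n).1 (X l) = 0 := by
    intro l hl
    rw [neg_lie, lie_skew, lie_apply_X, basisElt_apply_X_of_ne e hl.ne, basisElt_apply]
    rcases (Nat.lt_succ_iff.1 hl).lt_or_eq with hl' | hl'
    · rw [h.apply_X_eq_zero hl']
      simp
    · rw [Fin.ext hl', hDi]
      simp
  have htop : (⁅-basisElt K e, D⁆ : triangular K n).1 (X j) =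
      monomial (Finsupp.single a.i N) ((N + 1 : K) * coord K a D) := by
    have h0 : pderiv j (D.1 (X j)) = 0 := pderiv_eq_zero_of_notMem_vars fun hmem =>
      lt_irrefl j (mem_supported.1 (mem_supported_apply_X K D j) hmem)
    have h2 := basisElt_apply_X_self (K := K) e
    have h3 : (monomial (Finsupp.single a.i (N + 1)) 1 : MvPolynomial (Fin n) K) = X a.i ^ (N + 1) := by
      rw [X_pow_eq_monomial]
    rw [neg_lie, lie_skew, lie_apply_X, h2, basisElt_apply]
    change D.1 (monomial (Finsupp.single a.i (N + 1)) 1) - _ * pderiv j (D.1 (X j)) = _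
    rw [h0, mul_zero, sub_zero, h3, Derivation.leibniz_pow, hDi, Nat.add_sub_cancel, X_pow_eq_monomial,
      smul_eq_mul, mul_comm (monomial _ _), C_mul_monomial, ← map_nsmul]
    congr 1
    rw [nsmul_eq_mul]
    push_cast
    ring
  refine ⟨⟨j, Finsupp.single a.i N, hs _⟩, -basisElt K e, ?_, Or.inl hij, ?_, ?_⟩
  · rw [← not_lt, Index.pos_lt_pos_iff]
    rintro (hlt | ⟨hbj, p, hp1, hp2⟩)
    · exact absurd hlt (not_lt.2 (Nat.succ_le_of_lt hab))
    · simp only at hp1 hbj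
      rcases lt_trichotomy p a.i with hpk | rfl | hpk
      · have := hp2 _ hpk
        simp only [Finsupp.single_eq_same] at this
        omega
      · simp only [Finsupp.single_eq_same] at hp1
        omega
      · rw [b.α_eq_zero p (hbj ▸ Nat.succ_le_of_lt hpk)] at hp1
        omega
  · rw [coord_apply]
    simp only [htop, coeff_monomial, if_true]
    exact mul_ne_zero (by exact_mod_cast Nat.succ_ne_zero N) h.ne_zero
  · rintro d (hd | ⟨hd, p, hp1, hp2⟩)
    · exact coord_eq_zero_of_X (hlow _ hd)
    · simp only at hd hp1
      rw [coord_apply, hd, htop, coeff_monomial, if_neg]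
      intro heq
      rw [← heq] at hp1
      exact lt_irrefl _ hp1

/-- Well-founded induction on the leading term: for c < a, some bracket stays in I with a leading
term strictly below a and at least c. -/
theorem IsLeading.basisElt_mem [CharZero K] (I : LieIdeal K (triangular K n)) {D : triangular K n}
    {a : Index n} (h : IsLeading a D) (hD : D ∈ I) {b : Index n} (hb : b.pos ≤ a.pos) :
    basisElt K b ∈ I := by
  classical
  induction a using (Index.isWellOrder n).wf.induction generalizing D b with
  | _ a ih =>
    have hlt : ∀ c : Index n, c < a → basisElt K c ∈ I := by
      intro c hca
      have step : (∃ (a' : Index n) (E : triangular K n), c.pos ≤ a'.pos ∧ a' < a ∧ IsLeading a' ⁅E, D⁆) →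
          basisElt K c ∈ I := by
        rintro ⟨a', E, h1, h2, h3⟩
        exact ih a' h2 h3 (lie_mem_right K _ I E D hD) h1
      rcases id hca with hi | ⟨hi, -⟩
      · by_cases hα : a.α = 0
        · exact step (h.exists_lie_later hα hi)
        -- Here c lies in a later layer but a is not yet a bare ∂_i, so the descent first stays in
        -- the layer of a, at or above ∂_i, which is still above c.
        · have hlt' : (⟨a.i, 0, fun _ _ => rfl⟩ : Index n) < a := by
            rw [← Index.pos_lt_pos_iff, ← not_le, le_iff_lt_or_eq, Index.pos_lt_pos_iff,
              Index.pos_injective.eq_iff]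
            rintro ((hl | ⟨-, p, hp, -⟩) | heq)
            · exact absurd hl (lt_irrefl _)
            · simp at hp
            · exact hα (by rw [heq])
          obtain ⟨a', E, h1, h2, h3⟩ := h.exists_lie_same hlt' rfl
          refine ih a' h2 h3 (lie_mem_right K _ I E D hD) (le_trans ?_ h1)
          exact (Index.pos_lt_pos (b := c) (a := ⟨a.i, 0, fun _ _ => rfl⟩) (Or.inl hi)).le
      · exact step (h.exists_lie_same hca hi)
    rcases hb.lt_or_eq with hb | hb
    · exact hlt b (Index.pos_lt_pos_iff.1 hb)
    · obtain rfl := Index.pos_injective hb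
      -- All smaller basis elements are already in I, so removing them from D leaves a nonzero
      -- multiple of the leading one.
      have hrest : D - coord K b D • basisElt K b ∈ I := by
        have : D - coord K b D • basisElt K b ∈ Submodule.span K (basisElt K '' {c : Index n | c < b}) := by
          rw [mem_span_basisElt]
          intro c hc
          by_contra hcb
          apply hc
          rw [map_sub, map_smul, coord_basisElt, smul_eq_mul]
          split_ifs with hcb'
          · rw [hcb', mul_one, sub_self]
          · rw [mul_zero, sub_zero]
            rcases trichotomous_of (α := Index n) (· < ·) c b with h' | h' | h'
            · exact absurd h' hcb
            · exact absurd h' hcb'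
            · exact h.eq_zero c h'
        refine (Submodule.span_le (p := I.toSubmodule)).2 ?_ this
        rintro _ ⟨c, hc, rfl⟩
        exact hlt c hc
      have := I.sub_mem hD hrest
      rw [sub_sub_cancel] at this
      have h2 := I.smul_mem (coord K b D)⁻¹ this
      rwa [smul_smul, inv_mul_cancel₀ h.ne_zero, one_smul] at h2

theorem exists_eq_idealOf [CharZero K] (I : LieIdeal K (triangular K n)) :
    ∃ l ≤ omegaSum 0 n, I = idealOf K n l := by
  classical
  have key : ∀ l : Ordinal.{0}, (∀ a : Index n, basisElt K a ∈ I ↔ a.pos < l) → I = idealOf K n l := by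
    intro l hl
    ext D
    constructor
    · intro hD
      rcases eq_or_ne D 0 with rfl | hD0
      · exact zero_mem _
      · obtain ⟨a, ha⟩ := exists_isLeading hD0
        rw [mem_idealOf]
        intro b hb
        by_contra hne
        refine hb.not_gt ((hl b).1 (ha.basisElt_mem I hD ?_))
        by_contra hab
        exact hne (ha.eq_zero b (Index.pos_lt_pos_iff.1 (not_le.1 hab)))
    · intro hD
      refine (Submodule.span_le (p := I.toSubmodule)).2 ?_ hD
      rintro _ ⟨a, ha, rfl⟩
      refine (hl a).2 ?_
      rw [← Order.add_one_le_iff, ← Index.ord_eq]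
      exact ha
  by_cases hall : ∀ a : Index n, basisElt K a ∈ I
  · exact ⟨_, le_rfl, key _ fun a => ⟨fun _ => a.pos_lt_top, fun _ => hall a⟩⟩
  -- The position of the least basis element outside I is the required λ.
  · obtain ⟨c, hc, hmin⟩ := (Index.isWellOrder n).wf.has_min {a : Index n | basisElt K a ∉ I}
      (not_forall.1 hall)
    refine ⟨_, c.pos_lt_top.le, key _ fun a => ⟨fun ha => ?_, fun ha => ?_⟩⟩
    · by_contra hca
      refine hc (IsLeading.basisElt_mem I (a := a) ⟨?_, ?_⟩ ha (not_lt.1 hca))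
      · rw [coord_basisElt, if_pos rfl]
        exact one_ne_zero
      · intro b hb
        rw [coord_basisElt, if_neg]
        rintro rfl
        exact lt_irrefl _ (Index.pos_lt_pos hb)
    · by_contra hna
      exact hmin a hna (Index.pos_lt_pos_iff.1 ha)

end TriangularLie

namespace TriangularLie

variable {K : Type*} [Field K] {n s : ℕ}

/-! ### Homomorphisms that shift the ideals -/

/-- A surjective homomorphism under which the inverse image of each `I_ν` is `I_(δ+ν)`. -/
def IsShift (δ : Ordinal.{0}) (f : triangular K n →ₗ⁅K⁆ triangular K s) : Prop :=
  Function.Surjective f ∧ ∀ ν, (idealOf K s ν).comap f = idealOf K n (δ + ν)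

/-- Up to nonzero scalars, f sends the basis element at τ a to the one at a. It kills the basis
elements at positions below δ, since τ reaches exactly the positions from δ on. -/
theorem IsShift.of_coord {δ : Ordinal.{0}} {f : triangular K n →ₗ⁅K⁆ triangular K s}
    (hδ : δ + omegaSum 0 s = omegaSum 0 n) (τ : Index s → Index n)
    (hτ : ∀ a, (τ a).pos = δ + a.pos) (c : Index s → K) (hc : ∀ a, c a ≠ 0)
    (hf : ∀ a D, coord K a (f D) = c a * coord K (τ a) D) : IsShift δ f := by
  classical
  constructor
  · have hinj : Function.Injective τ := fun a b h => Index.pos_injective <| by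
      have := hτ a
      rwa [h, hτ, add_right_inj, eq_comm] at this
    have hmem : ∀ D, D ∈ LinearMap.range (f : triangular K n →ₗ[K] triangular K s) := by
      intro D
      have hD : D ∈ Submodule.span K (Set.range (basisElt K (n := s))) := by
        rw [span_basisElt]
        trivial
      refine Submodule.span_le.2 ?_ hD
      rintro _ ⟨a, rfl⟩
      refine ⟨(c a)⁻¹ • basisElt K (τ a), ext_coord fun b => ?_⟩
      rw [map_smul, map_smul, LieHom.coe_toLinearMap, hf, coord_basisElt, coord_basisElt,
        hinj.eq_iff]
      split_ifs with h
      · rw [h, mul_one, smul_eq_mul, inv_mul_cancel₀ (hc a)]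
      · rw [mul_zero, smul_zero]
    exact fun D => hmem D
  · intro ν
    ext D
    rw [LieIdeal.mem_comap, mem_idealOf, mem_idealOf]
    constructor
    · intro h b hb
      obtain ⟨o, ho⟩ := exists_add_of_le (le_self_add.trans hb)
      have hlt : o < omegaSum 0 s := by
        rw [← add_lt_add_iff_left δ, hδ, ← ho]
        exact b.pos_lt_top
      obtain ⟨a, rfl⟩ := Index.exists_pos_eq_of_lt hlt
      obtain rfl : b = τ a := Index.pos_injective (by rw [ho, hτ])
      rw [ho, add_le_add_iff_left] at hb
      have := h a hb
      rw [hf] at this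
      exact (mul_eq_zero.1 this).resolve_left (hc a)
    · intro h a ha
      rw [hf, h (τ a) (by rw [hτ]; gcongr), mul_zero]

theorem IsShift.comp {t : ℕ} {δ ε : Ordinal.{0}} {f : triangular K n →ₗ⁅K⁆ triangular K s}
    {g : triangular K s →ₗ⁅K⁆ triangular K t} (hf : IsShift δ f) (hg : IsShift ε g) :
    IsShift (δ + ε) (g.comp f) := by
  refine ⟨hg.1.comp hf.1, fun ν => ?_⟩
  rw [add_assoc, ← hf.2, ← hg.2]
  rfl

theorem IsShift.id : IsShift 0 (LieHom.id : triangular K n →ₗ⁅K⁆ triangular K n) :=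
  ⟨Function.surjective_id, fun ν => by rw [zero_add]; rfl⟩

/-! #### Restriction to fewer variables -/

section restrict

variable (h : s ≤ n)

theorem exists_rename_eq {k : Fin s} {f : MvPolynomial (Fin n) K}
    (hf : f ∈ supported K {j | j < Fin.castLE h k}) :
    ∃ g ∈ supported K {j : Fin s | j < k}, rename (Fin.castLE h) g = f := by
  have hset : (X '' {j : Fin n | j < Fin.castLE h k} : Set (MvPolynomial (Fin n) K)) =
      rename (Fin.castLE h) '' (X '' {j : Fin s | j < k}) := by
    ext p
    constructor
    · rintro ⟨j, hj, rfl⟩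
      have hj' : (j : ℕ) < k := hj
      exact ⟨X ⟨j, hj'.trans k.2⟩, ⟨_, hj', rfl⟩, by rw [rename_X]; rfl⟩
    · rintro ⟨_, ⟨j, hj, rfl⟩, rfl⟩
      exact ⟨Fin.castLE h j, hj, by rw [rename_X]⟩
  rw [supported, hset, ← AlgHom.map_adjoin] at hf
  exact hf

/-- The restriction of a triangular derivation to the polynomials in the first variables. -/
def restrictDerivation (D : triangular K n) :
    Derivation K (MvPolynomial (Fin s) K) (MvPolynomial (Fin s) K) :=
  mkDerivation K fun k => killCompl (Fin.castLE_injective h) (D.1 (X (Fin.castLE h k)))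

theorem restrictDerivation_X (D : triangular K n) (k : Fin s) :
    restrictDerivation h D (X k) ∈ supported K {j : Fin s | j < k} ∧
      rename (Fin.castLE h) (restrictDerivation h D (X k)) = D.1 (X (Fin.castLE h k)) := by
  obtain ⟨g, hg, hgD⟩ := exists_rename_eq h (mem_supported_apply_X K D (Fin.castLE h k))
  rw [restrictDerivation, mkDerivation_X, ← hgD, killCompl_rename_app]
  exact ⟨hg, rfl⟩

/-- A triangular derivation preserves the subalgebra of the first s variables. As `rename` is
injective there, this identity yields linearity and compatibility with brackets. -/
theorem rename_restrictDerivation (D : triangular K n) (f : MvPolynomial (Fin s) K) :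
    rename (Fin.castLE h) (restrictDerivation h D f) = D.1 (rename (Fin.castLE h) f) := by
  induction f using MvPolynomial.induction_on with
  | C a => rw [rename_C, derivation_C, derivation_C, map_zero]
  | add p q hp hq => simp only [map_add, hp, hq]
  | mul_X p k hp =>
    simp only [map_mul, Derivation.leibniz, smul_eq_mul, map_add, hp, (restrictDerivation_X h D k).2,
      rename_X]

/-- Restriction of triangular derivations, as a Lie algebra homomorphism. -/
def restrict : triangular K n →ₗ⁅K⁆ triangular K s where
  toFun D := ⟨restrictDerivation h D, (exists_sum_iff K s _).2 fun k => (restrictDerivation_X h D k).1⟩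
  map_add' D E := Subtype.ext <| Derivation.ext fun f =>
    rename_injective _ (Fin.castLE_injective h) <| by
      simp [rename_restrictDerivation]
  map_smul' c D := Subtype.ext <| Derivation.ext fun f =>
    rename_injective _ (Fin.castLE_injective h) <| by
      simp [rename_restrictDerivation]
  map_lie' {D E} := Subtype.ext <| Derivation.ext fun f =>
    rename_injective _ (Fin.castLE_injective h) <| by
      simp [rename_restrictDerivation, Derivation.commutator_apply]

/-- A basis element in fewer variables, seen as one in more variables. -/
def Index.castLE (a : Index s) : Index n where
  i := Fin.castLE h a.i
  α := a.α.mapDomain (Fin.castLE h)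
  α_eq_zero j hj := by
    by_cases hjs : (j : ℕ) < s
    · have : j = Fin.castLE h ⟨j, hjs⟩ := rfl
      rw [this, Finsupp.mapDomain_apply (Fin.castLE_injective h)]
      exact a.α_eq_zero _ hj
    · rw [Finsupp.mapDomain_of_notMem_range]
      rintro ⟨k, rfl⟩
      exact hjs k.2

theorem Index.pos_castLE (a : Index s) : (a.castLE h).pos = omegaSum s n + a.pos := by
  rw [Index.pos, Index.pos, ← add_assoc, omegaSum_add a.i.2 h]
  congr 1
  refine digits_congr fun j hj => ?_
  have hj' : j < a.i := hj
  have hjs : j < s := hj'.trans a.i.2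
  rw [Index.digit, Index.digit, dif_pos hjs, dif_pos (hjs.trans_le h)]
  exact Finsupp.mapDomain_apply (Fin.castLE_injective h) a.α ⟨j, hjs⟩

theorem isShift_restrict : IsShift (omegaSum s n) (restrict (K := K) h) := by
  refine .of_coord (omegaSum_add (Nat.zero_le _) h) (Index.castLE h) (Index.pos_castLE h)
    (fun _ => 1) (fun _ => one_ne_zero) fun a D => ?_
  rw [one_mul, coord_apply, coord_apply]
  change coeff a.α (restrictDerivation h D (X a.i)) = coeff (a.α.mapDomain _) (D.1 (X (Fin.castLE h a.i)))
  rw [← (restrictDerivation_X h D a.i).2, coeff_rename_mapDomain _ (Fin.castLE_injective h)]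

end restrict

/-! #### Differentiation of the last layer -/

/-- `∂_t` applied to the component of a derivation at the last variable, where `t` is the
second last variable. -/
def diffLastDerivation (D : triangular K (s + 2)) :
    Derivation K (MvPolynomial (Fin (s + 2)) K) (MvPolynomial (Fin (s + 2)) K) :=
  mkDerivation K fun k => if k = Fin.last (s + 1) then pderiv (Fin.last s).castSucc (D.1 (X k))
    else D.1 (X k)

theorem diffLastDerivation_X_last (D : triangular K (s + 2)) :
    diffLastDerivation D (X (Fin.last (s + 1))) =
      pderiv (Fin.last s).castSucc (D.1 (X (Fin.last (s + 1)))) := by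
  rw [diffLastDerivation, mkDerivation_X, if_pos rfl]

theorem diffLastDerivation_X_of_ne (D : triangular K (s + 2)) {k : Fin (s + 2)}
    (hk : k ≠ Fin.last (s + 1)) : diffLastDerivation D (X k) = D.1 (X k) := by
  rw [diffLastDerivation, mkDerivation_X, if_neg hk]

theorem diffLastDerivation_apply (D : triangular K (s + 2)) {f : MvPolynomial (Fin (s + 2)) K}
    (hf : f ∈ supported K {j : Fin (s + 2) | j < Fin.last (s + 1)}) :
    diffLastDerivation D f = D.1 f :=
  derivation_eqOn_supported (fun _ hj => diffLastDerivation_X_of_ne D (ne_of_lt hj)) hf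

theorem pderiv_mem_supported {i j : Fin n} {f : MvPolynomial (Fin n) K}
    (hf : f ∈ supported K {j : Fin n | j < i}) : pderiv j f ∈ supported K {j : Fin n | j < i} := by
  classical
  refine map_supported K n (D := pderiv j) (fun k => ?_) i hf
  rw [pderiv_X]
  by_cases hjk : j = k
  · subst hjk
    simp
  · simp [Ne.symm hjk]

/-- On generators x_j up to the second last variable, D x_j does not contain that variable and its
derivative of x_j is constant, so the commutator vanishes. This is what makes `diffLast` respect
brackets. -/
theorem apply_pderiv_comm (D : triangular K (s + 2)) {f : MvPolynomial (Fin (s + 2)) K}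
    (hf : f ∈ supported K {j : Fin (s + 2) | j < Fin.last (s + 1)}) :
    D.1 (pderiv (Fin.last s).castSucc f) = pderiv (Fin.last s).castSucc (D.1 f) := by
  have h : (⁅D.1, pderiv (Fin.last s).castSucc⁆ :
      Derivation K (MvPolynomial (Fin (s + 2)) K) (MvPolynomial (Fin (s + 2)) K)) f = 0 := by
    refine derivation_eqOn_supported (D₂ := 0) (fun j hj => ?_) hf
    have hj' : j ≤ (Fin.last s).castSucc := Nat.lt_succ_iff.1 hj
    classical
    have h1 : pderiv (Fin.last s).castSucc (D.1 (X j)) = 0 :=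
      pderiv_eq_zero_of_notMem_vars fun hmem =>
        absurd (mem_supported.1 (mem_supported_apply_X K D j) hmem) (not_lt.2 hj')
    simp only [Function.comp_apply, Derivation.commutator_apply, h1, pderiv_X, Pi.single_apply]
    split_ifs <;> simp
  rw [Derivation.commutator_apply, sub_eq_zero] at h
  exact h

/-- The endomorphism that is the identity on the layers of all variables but the last, and the
derivative by the second last variable on the layer of the last. -/
def diffLast : triangular K (s + 2) →ₗ⁅K⁆ triangular K (s + 2) where
  toFun D := ⟨diffLastDerivation D, (exists_sum_iff K _ _).2 fun k => by
    rcases eq_or_ne k (Fin.last (s + 1)) with rfl | hk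
    · rw [diffLastDerivation_X_last]
      exact pderiv_mem_supported (mem_supported_apply_X K D _)
    · rw [diffLastDerivation_X_of_ne D hk]
      exact mem_supported_apply_X K D k⟩
  map_add' D E := Subtype.ext <| derivation_ext fun k => by
    rcases eq_or_ne k (Fin.last (s + 1)) with rfl | hk
    · simp [diffLastDerivation_X_last]
    · simp [diffLastDerivation_X_of_ne _ hk]
  map_smul' c D := Subtype.ext <| derivation_ext fun k => by
    rcases eq_or_ne k (Fin.last (s + 1)) with rfl | hk
    · simp [diffLastDerivation_X_last]
    · simp [diffLastDerivation_X_of_ne _ hk]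
  map_lie' {D E} := Subtype.ext <| derivation_ext fun k => by
    have hle : ∀ D : triangular K (s + 2), D.1 (X k) ∈ supported K {j : Fin (s + 2) | j < Fin.last (s + 1)} :=
      fun D => supported_mono (fun j (hj : j < k) => hj.trans_le (Fin.le_last k))
        (mem_supported_apply_X K D k)
    change _ = (⁅diffLastDerivation D, diffLastDerivation E⁆ :
      Derivation K (MvPolynomial (Fin (s + 2)) K) (MvPolynomial (Fin (s + 2)) K)) (X k)
    rw [Derivation.commutator_apply]
    change diffLastDerivation ⁅D, E⁆ (X k) = diffLastDerivation D (diffLastDerivation E (X k)) -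
      diffLastDerivation E (diffLastDerivation D (X k))
    rcases eq_or_ne k (Fin.last (s + 1)) with rfl | hk
    · simp only [diffLastDerivation_X_last]
      rw [diffLastDerivation_apply _ (pderiv_mem_supported (hle _)),
        diffLastDerivation_apply _ (pderiv_mem_supported (hle _)), apply_pderiv_comm _ (hle _),
        apply_pderiv_comm _ (hle _), lie_apply_X, map_sub]
    · simp only [diffLastDerivation_X_of_ne _ hk]
      rw [diffLastDerivation_apply _ (hle _), diffLastDerivation_apply _ (hle _), lie_apply_X]

/-- Multiplication by the second last variable on the layer of the last variable. -/
def Index.mulLast (a : Index (s + 2)) : Index (s + 2) where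
  i := a.i
  α := if a.i = Fin.last (s + 1) then a.α + Finsupp.single (Fin.last s).castSucc 1 else a.α
  α_eq_zero j hj := by
    split_ifs with h
    · rw [h] at hj
      have hne : j ≠ (Fin.last s).castSucc := by
        rintro rfl
        exact absurd hj (not_le.2 (Fin.castSucc_lt_last _))
      simp [a.α_eq_zero j (h ▸ hj), Finsupp.single_eq_of_ne hne]
    · exact a.α_eq_zero j hj

theorem opow_add_of_le {k l : ℕ} {o : Ordinal.{0}} (hkl : k < l) (ho : Ordinal.omega0 ^ l ≤ o) :
    Ordinal.omega0 ^ k + o = o := by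
  rw [← Ordinal.opow_natCast] at ho ⊢
  exact Ordinal.add_of_omega0_opow_le
    ((Ordinal.opow_lt_opow_iff_right Ordinal.one_lt_omega0).2 (by exact_mod_cast hkl)) ho

/-- In the last layer the top digit grows by one, and ω^s + ω^s c = ω^s (1 + c). Every other layer
starts at ω^(s+1) or later, where ω^s is absorbed from the left. -/
theorem Index.pos_mulLast (a : Index (s + 2)) :
    a.mulLast.pos = Ordinal.omega0 ^ s + a.pos := by
  by_cases h : a.i = Fin.last (s + 1)
  · have hi : ((Fin.last (s + 1) : Fin (s + 2)) : ℕ) = s + 1 := rfl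
    have hi' : a.mulLast.i = Fin.last (s + 1) := h
    rw [Index.pos, Index.pos, hi', h, hi, omegaSum_eq_zero le_rfl, zero_add, zero_add, digits, digits,
      ← add_assoc, ← mul_one_add, ← Nat.cast_one (R := Ordinal.{0}), ← Nat.cast_add]
    have hd : ∀ j, j < s + 2 → a.mulLast.digit j = a.digit j + if j = s then 1 else 0 := by
      intro j hj
      rw [Index.digit, Index.digit, dif_pos hj, dif_pos hj]
      simp [Index.mulLast, h, Finsupp.single_apply, Fin.ext_iff, eq_comm]
    rw [hd s (by omega), if_pos rfl, add_comm 1]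
    congr 1
    exact digits_congr fun j hj => by rw [hd j (by omega), if_neg hj.ne, add_zero]
  · rw [opow_add_of_le s.lt_succ_self]
    · have : a.mulLast = a := by
        obtain ⟨i, α, hα⟩ := a
        simp only [Index.mulLast, Index.mk.injEq, true_and]
        exact if_neg h
      rw [this]
    · rw [← omegaSum_self_succ]
      exact (omegaSum_anti (Fin.lt_last_iff_ne_last.2 h) _).trans le_self_add

theorem isShift_diffLast [CharZero K] :
    IsShift (Ordinal.omega0 ^ s) (diffLast : triangular K (s + 2) →ₗ⁅K⁆ _) := by
  refine .of_coord ?_ Index.mulLast Index.pos_mulLast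
    -- The factor is the exponent brought down by differentiation, nonzero in characteristic zero.
    (fun a => if a.i = Fin.last (s + 1) then a.α (Fin.last s).castSucc + 1 else 1) (fun a => ?_) fun a D => ?_
  · refine opow_add_of_le s.lt_succ_self ?_
    rw [← omegaSum_self_succ]
    exact omegaSum_anti (Nat.zero_le _) _
  · split_ifs
    · exact Nat.cast_add_one_ne_zero _
    · exact one_ne_zero
  · rw [coord_apply, coord_apply]
    change coeff a.α (diffLastDerivation D (X a.i)) = _ * coeff _ (D.1 (X a.i))
    by_cases h : a.i = Fin.last (s + 1)
    · rw [if_pos h, h, diffLastDerivation_X_last, coeff_pderiv, mul_comm]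
      simp [Index.mulLast, h]
    · rw [if_neg h, one_mul, diffLastDerivation_X_of_ne _ h]
      simp [Index.mulLast, h]

theorem exists_isShift_natCast_mul [CharZero K] (i : ℕ) :
    ∃ f : triangular K (s + 2) →ₗ⁅K⁆ triangular K (s + 2), IsShift (Ordinal.omega0 ^ s * i) f := by
  induction i with
  | zero => exact ⟨_, by simpa using IsShift.id⟩
  | succ i ih =>
    obtain ⟨f, hf⟩ := ih
    exact ⟨_, by simpa [mul_add_one] using hf.comp isShift_diffLast⟩

/-- The projection of a Lie algebra onto a factor algebra. -/
def quotientMk {L : Type*} [LieRing L] [LieAlgebra K L] (I : LieIdeal K L) : L →ₗ⁅K⁆ L ⧸ I :=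
  { I.toSubmodule.mkQ with map_lie' := rfl }

theorem quotientMk_surjective {L : Type*} [LieRing L] [LieAlgebra K L] (I : LieIdeal K L) :
    Function.Surjective (quotientMk I) :=
  Submodule.mkQ_surjective _

theorem quotientMk_eq_zero {L : Type*} [LieRing L] [LieAlgebra K L] {I : LieIdeal K L} {x : L} :
    quotientMk I x = 0 ↔ x ∈ I :=
  Submodule.Quotient.mk_eq_zero I.toSubmodule

/-- The isomorphism of the factor algebras that a shift induces. -/
theorem IsShift.nonempty_equiv {δ : Ordinal.{0}} {f : triangular K n →ₗ⁅K⁆ triangular K s}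
    (hf : IsShift δ f) (ν : Ordinal.{0}) :
    Nonempty ((triangular K n ⧸ idealOf K n (δ + ν)) ≃ₗ⁅K⁆ (triangular K s ⧸ idealOf K s ν)) := by
  set g := (quotientMk (idealOf K s ν)).comp f with hg
  have hker : g.ker = idealOf K n (δ + ν) := by
    rw [← hf.2]
    ext D
    rw [LieHom.mem_ker, LieIdeal.mem_comap, hg, LieHom.comp_apply, quotientMk_eq_zero]
  rw [← hker]
  refine ⟨g.quotKerEquivRange.trans (LieEquiv.ofBijective g.range.incl ⟨Subtype.val_injective, fun x => ?_⟩)⟩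
  obtain ⟨D, rfl⟩ := (quotientMk_surjective _).comp hf.1 x
  exact ⟨⟨_, D, rfl⟩, rfl⟩

end TriangularLie

namespace TriangularLie

open Ordinal

variable {K : Type*} [Field K] {n m s t : ℕ}

/-! ### The ideals of a factor algebra -/

section Factor

variable {Q : Type*} [LieRing Q] [LieAlgebra K Q]

theorem comap_map_eq_sup_ker {f : triangular K n →ₗ⁅K⁆ Q} (hf : Function.Surjective f)
    (I : LieIdeal K (triangular K n)) : (I.map f).comap f = I ⊔ f.ker :=
  LieIdeal.comap_map_eq (congrArg (fun p : Submodule K Q => (p : Set Q))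
    (LieIdeal.coe_map_of_surjective (I := I) hf))

variable [CharZero K]

/-- Ideals of Q correspond to the I_(l+o) containing the kernel; sending each to its o loses no
intermediate value, so it is an initial segment of the ordinals. -/
theorem exists_initialSeg_of_ker_eq {l : Ordinal.{0}} (hl : l ≤ omegaSum 0 n)
    {f : triangular K n →ₗ⁅K⁆ Q} (hf : Function.Surjective f) (hker : f.ker = idealOf K n l) :
    ∃ r : InitialSeg ((· < ·) : LieIdeal K Q → LieIdeal K Q → Prop)
        ((· < ·) : Ordinal.{0} → Ordinal.{0} → Prop),
      ∀ B, l + r B ≤ omegaSum 0 n ∧ B.comap f = idealOf K n (l + r B) := by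
  have hex : ∀ B : LieIdeal K Q, ∃ o : Ordinal.{0}, l + o ≤ omegaSum 0 n ∧
      B.comap f = idealOf K n (l + o) := by
    intro B
    obtain ⟨l', hl', hB⟩ := exists_eq_idealOf (B.comap f)
    have hle : idealOf K n l ≤ idealOf K n l' := by
      rw [← hB, ← hker]
      exact LieHom.ker_le_comap f B
    obtain ⟨o, rfl⟩ := exists_add_of_le ((idealOf_le_iff hl).1 hle)
    exact ⟨o, hl', hB⟩
  choose r hr hrB using hex
  have hcomap : ∀ B B' : LieIdeal K Q, B.comap f ≤ B'.comap f ↔ B ≤ B' := by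
    intro B B'
    refine ⟨fun h x hx => ?_, fun h => LieIdeal.comap_mono h⟩
    obtain ⟨y, rfl⟩ := hf x
    exact LieIdeal.mem_comap.1 (h (LieIdeal.mem_comap.2 hx))
  have hlt : ∀ B B' : LieIdeal K Q, r B < r B' ↔ B < B' := by
    intro B B'
    rw [lt_iff_le_not_ge (a := B), ← hcomap, ← hcomap, ← lt_iff_le_not_ge, hrB, hrB,
      idealOf_lt_iff (hr _) (hr _), add_lt_add_iff_left]
  have hinj : Function.Injective r := by
    intro B B' h
    refine le_antisymm ((hcomap _ _).1 ?_) ((hcomap _ _).1 ?_) <;> rw [hrB, hrB, h]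
  refine ⟨⟨⟨⟨r, hinj⟩, fun {B B'} => hlt B B'⟩, fun B o ho => ?_⟩, fun B => ⟨hr B, hrB B⟩⟩
  change o < r B at ho
  refine ⟨(idealOf K n (l + o)).map f, ?_⟩
  change r _ = o
  have hle : l + o ≤ omegaSum 0 n := le_trans (by gcongr) (hr B)
  have h := hrB ((idealOf K n (l + o)).map f)
  rw [comap_map_eq_sup_ker hf, hker,
    sup_eq_left.2 (idealOf_mono le_self_add), idealOf_inj hle (hr _), add_right_inj] at h
  exact h.symm

/-- Two initial embeddings into the ordinals agree, so the offset o of an ideal of Q does not depend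
on the presentation of Q. -/
theorem exists_comap_eq {l l' : Ordinal.{0}} (hl : l ≤ omegaSum 0 n) (hl' : l' ≤ omegaSum 0 m)
    {f : triangular K n →ₗ⁅K⁆ Q} (hf : Function.Surjective f) (hfker : f.ker = idealOf K n l)
    {g : triangular K m →ₗ⁅K⁆ Q} (hg : Function.Surjective g) (hgker : g.ker = idealOf K m l')
    {o : Ordinal.{0}} (ho : l + o ≤ omegaSum 0 n) :
    l' + o ≤ omegaSum 0 m ∧
      ∃ B : LieIdeal K Q, B.comap f = idealOf K n (l + o) ∧ B.comap g = idealOf K m (l' + o) := by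
  obtain ⟨r, hr⟩ := exists_initialSeg_of_ker_eq hl hf hfker
  obtain ⟨r', hr'⟩ := exists_initialSeg_of_ker_eq hl' hg hgker
  obtain ⟨B, rfl⟩ : ∃ B, r B = o := by
    have h := (hr ((idealOf K n (l + o)).map f)).2
    rw [comap_map_eq_sup_ker hf, hfker,
      sup_eq_left.2 (idealOf_mono le_self_add), idealOf_inj ho (hr _).1, add_right_inj] at h
    exact ⟨_, h.symm⟩
  have heq : r B = r' B := InitialSeg.eq r r' B
  refine ⟨heq ▸ (hr' B).1, B, (hr B).2, ?_⟩
  rw [heq]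
  exact (hr' B).2

end Factor

/-! ### The number of variables as an invariant -/

theorem omegaSum_zero_strictMono : StrictMono (omegaSum 0) := by
  refine strictMono_nat_of_lt_succ fun k => ?_
  have h : omegaSum 0 k < ω ^ k := by
    induction k with
    | zero => exact one_pos
    | succ k ih =>
      have := opow_mul_add_lt (c := 1) ih
      rwa [Nat.cast_one, mul_one] at this
  rw [omegaSum, if_pos (Nat.zero_le _)]
  exact h.trans_le le_self_add

theorem add_omegaSum_zero {ν : Ordinal.{0}} (hν : ν < ω ^ (s - 2)) :
    ν + omegaSum 0 s = omegaSum 0 s := by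
  rcases lt_or_ge s 2 with hs | hs
  -- For s < 2 truncated subtraction makes the bound ω^0 = 1, which forces ν = 0.
  · rw [Nat.sub_eq_zero_of_le hs.le, pow_zero, Order.lt_one_iff] at hν
    rw [hν, zero_add]
  · obtain ⟨s, rfl⟩ := Nat.exists_eq_add_of_le' hs
    have h : ω ^ s ≤ omegaSum 0 (s + 2) := by
      refine (pow_le_pow_right₀ (one_lt_omega0.le) s.le_succ).trans ?_
      rw [← omegaSum_self_succ]
      exact omegaSum_anti (Nat.zero_le _) _
    rw [Nat.add_sub_cancel] at hν
    rw [← opow_natCast] at hν h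
    exact add_of_omega0_opow_le hν h

/-- Absorption of ν makes the whole algebra the ideal at offset `omegaSum 0 s`, so comparing
greatest offsets gives s = t. -/
theorem eq_of_surjective [CharZero K] {Q : Type*} [LieRing Q] [LieAlgebra K Q] {ν ν' : Ordinal.{0}}
    (hν : ν < ω ^ (s - 2)) (hν' : ν' < ω ^ (t - 2))
    {f : triangular K s →ₗ⁅K⁆ Q} (hf : Function.Surjective f) (hfker : f.ker = idealOf K s ν)
    {g : triangular K t →ₗ⁅K⁆ Q} (hg : Function.Surjective g) (hgker : g.ker = idealOf K t ν') :
    s = t := by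
  have h : ν + omegaSum 0 s = omegaSum 0 s := add_omegaSum_zero hν
  have h' : ν' + omegaSum 0 t = omegaSum 0 t := add_omegaSum_zero hν'
  have hle : ν ≤ omegaSum 0 s := le_self_add.trans h.le
  have hle' : ν' ≤ omegaSum 0 t := le_self_add.trans h'.le
  have h1 := (exists_comap_eq hle hle' hf hfker hg hgker h.le).1
  have h2 := (exists_comap_eq hle' hle hg hgker hf hfker h'.le).1
  refine omegaSum_zero_strictMono.injective (le_antisymm ?_ ?_)
  · rwa [← add_le_add_iff_left ν', h']
  · rwa [← add_le_add_iff_left ν, h]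

/-! ### The remainder ν as an invariant -/

theorem lie_eq_of_i_eq {a b : Index (s + 2)} (ha : a.i = (Fin.last s).castSucc)
    (hb : b.i = Fin.last (s + 1)) : (⁅basisElt K a, basisElt K b⁆ : triangular K (s + 2)).1 =
      (monomial a.α (1 : K) * pderiv (Fin.last s).castSucc (monomial b.α 1)) • pderiv (Fin.last (s + 1)) := by
  change ⁅(monomial a.α 1 : MvPolynomial (Fin (s + 2)) K) • pderiv a.i,
      (monomial b.α 1 : MvPolynomial (Fin (s + 2)) K) • pderiv b.i⁆ = _
  rw [lie_smul_pderiv, ha, hb, pderiv_monomial (i := Fin.last (s + 1)),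
    a.α_eq_zero _ (by rw [ha]; exact Fin.le_last _)]
  simp

/-- The basis element `x_s ∂_(s+1)`. -/
def Index.xLast (s : ℕ) : Index (s + 2) where
  i := Fin.last (s + 1)
  α := Finsupp.single (Fin.last s).castSucc 1
  α_eq_zero _ hj := Finsupp.single_eq_of_ne ((Fin.castSucc_lt_last _).trans_le hj).ne'

/-- A basis element of the second last layer, moved to the last layer. -/
def Index.toLast (a : Index (s + 2)) (ha : a.i = (Fin.last s).castSucc) : Index (s + 2) where
  i := Fin.last (s + 1)
  α := a.α
  α_eq_zero j hj := a.α_eq_zero j (by rw [ha]; exact (Fin.castSucc_lt_last _).le.trans hj)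

theorem lie_xLast {a : Index (s + 2)} (ha : a.i = (Fin.last s).castSucc) :
    ⁅basisElt K a, basisElt K (Index.xLast s)⁆ = basisElt K (a.toLast ha) := by
  apply Subtype.ext
  rw [lie_eq_of_i_eq ha rfl]
  change _ = monomial a.α (1 : K) • pderiv (Fin.last (s + 1))
  congr 1
  rw [pderiv_monomial]
  simp [Index.xLast]

theorem Index.pos_of_i_eq_last {b : Index (s + 2)} (hb : b.i = Fin.last (s + 1)) :
    b.pos = ω ^ s * b.digit s + digits s b.digit := by
  have hi : ((Fin.last (s + 1) : Fin (s + 2)) : ℕ) = s + 1 := rfl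
  rw [Index.pos, hb, hi, omegaSum_eq_zero le_rfl, zero_add]
  rfl

theorem digits_zero (k : ℕ) : digits k (fun _ => 0) = 0 := by
  induction k with
  | zero => rfl
  | succ k ih => rw [digits, ih, Nat.cast_zero, mul_zero, add_zero]

theorem Index.pos_xLast (s : ℕ) : (Index.xLast s).pos = ω ^ s := by
  have h : ∀ j < s + 1, (Index.xLast s).digit j = if j = s then 1 else 0 := fun j hj => by
    simp [Index.digit, Index.xLast, Finsupp.single_apply, Fin.ext_iff, eq_comm, hj.trans (Nat.lt_succ_self _)]
  rw [Index.pos_of_i_eq_last rfl, h s (by omega), if_pos rfl, Nat.cast_one, mul_one,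
    digits_congr fun j hj => (h j (by omega)).trans (if_neg hj.ne), add_eq_left]
  exact digits_zero s

theorem Index.pos_of_i_eq {a : Index (s + 2)} (ha : a.i = (Fin.last s).castSucc) :
    a.pos = ω ^ (s + 1) + (a.toLast ha).pos := by
  have h0 : (a.toLast ha).digit s = 0 := by
    rw [Index.digit, dif_pos (by omega)]
    exact a.α_eq_zero _ (by rw [ha]; exact le_rfl)
  rw [Index.pos_of_i_eq_last (b := a.toLast ha) rfl, h0, Nat.cast_zero, mul_zero, zero_add, Index.pos, ha,
    ← omegaSum_self_succ (s + 1)]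
  rfl

theorem Index.i_of_pos_lt {a : Index (s + 2)} {ν : Ordinal.{0}} (hν : ν < ω ^ s)
    (ha : a.pos < ω ^ (s + 1) + ν) : a.i = (Fin.last s).castSucc ∨ a.i = Fin.last (s + 1) := by
  have hs : s ≤ a.i := by
    by_contra hs
    refine absurd ha (not_lt.2 ?_)
    calc ω ^ (s + 1) + ν ≤ ω ^ (s + 1) + ω ^ s := by gcongr
      _ = omegaSum s (s + 2) := by rw [← omegaSum_self_succ (s + 1), omegaSum_succ_add (by omega)]
      _ ≤ omegaSum (a.i + 1) (s + 2) := omegaSum_anti (by omega) _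
      _ ≤ a.pos := le_self_add
  have := a.i.2
  rcases hs.eq_or_lt with h | h
  · exact Or.inl (Fin.ext h.symm)
  · exact Or.inr (Fin.ext (by rw [Fin.val_last]; omega))

/-- The first ideal meets only the last two layers. The second is spanned by last-layer elements
free of the second last variable, together with that variable times the last ∂. Only this extra
element brackets nontrivially, moving the element at ω^(s+1) + r to position r < ν. -/
theorem lie_mem_idealOf {ν : Ordinal.{0}} (hν : ν < ω ^ s) {D E : triangular K (s + 2)}
    (hD : D ∈ idealOf K (s + 2) (ω ^ (s + 1) + ν)) (hE : E ∈ idealOf K (s + 2) (ω ^ s + 1)) :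
    ⁅D, E⁆ ∈ idealOf K (s + 2) ν := by
  have hbasis : ∀ a b : Index (s + 2), a.pos < ω ^ (s + 1) + ν → b.pos < ω ^ s + 1 →
      ⁅basisElt K a, basisElt K b⁆ ∈ idealOf K (s + 2) ν := by
    intro a b ha hb
    rw [Order.lt_add_one_iff] at hb
    have hbi : b.i = Fin.last (s + 1) := by
      by_contra hne
      refine absurd hb (not_le.2 ?_)
      have hpow : (ω : Ordinal.{0}) ^ s < ω ^ (s + 1) := by
        simpa using opow_mul_add_lt (c := 1) (pow_pos omega0_pos s)
      refine hpow.trans_le ?_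
      rw [← omegaSum_self_succ]
      exact (omegaSum_anti (Fin.lt_last_iff_ne_last.2 hne) _).trans le_self_add
    rcases Index.i_of_pos_lt hν ha with hai | hai
    · rcases hb.lt_or_eq with hb | hb
      · have h0 : b.digit s = 0 := by
          by_contra h0
          rw [Index.pos_of_i_eq_last hbi] at hb
          refine absurd (le_self_add.trans_lt hb) (not_lt.2 ?_)
          exact le_mul_of_one_le_right zero_le (by exact_mod_cast Nat.one_le_iff_ne_zero.2 h0)
        have h0' : b.α (Fin.last s).castSucc = 0 := by rwa [← Index.digit_val]
        have : ⁅basisElt K a, basisElt K b⁆ = 0 := by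
          apply Subtype.ext
          rw [lie_eq_of_i_eq hai hbi, pderiv_monomial, h0']
          simp
        rw [this]
        exact zero_mem _
      · obtain rfl : b = Index.xLast s := Index.pos_injective (by rw [hb, Index.pos_xLast])
        rw [lie_xLast hai, basisElt_mem_idealOf]
        rwa [Index.pos_of_i_eq hai, add_lt_add_iff_left] at ha
    · have : ⁅basisElt K a, basisElt K b⁆ = 0 := by
        apply Subtype.ext
        change ⁅(monomial a.α 1 : MvPolynomial (Fin (s + 2)) K) • pderiv a.i,
          (monomial b.α 1 : MvPolynomial (Fin (s + 2)) K) • pderiv b.i⁆ = 0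
        rw [lie_smul_pderiv, pderiv_monomial, pderiv_monomial, a.α_eq_zero _ (by rw [hai, hbi]),
          b.α_eq_zero _ (by rw [hai, hbi])]
        simp
      rw [this]
      exact zero_mem _
  change D ∈ Submodule.span K (basisElt K '' {a : Index (s + 2) | a.ord ≤ _}) at hD
  change E ∈ Submodule.span K (basisElt K '' {a : Index (s + 2) | a.ord ≤ _}) at hE
  induction hD using Submodule.span_induction with
  | zero => rw [zero_lie]; exact zero_mem _
  | add x y _ _ hx hy => rw [add_lie]; exact add_mem hx hy
  | smul c x _ hx => rw [smul_lie]; exact Submodule.smul_mem _ c hx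
  | mem x hx =>
    obtain ⟨a, ha, rfl⟩ := hx
    induction hE using Submodule.span_induction with
    | zero => rw [lie_zero]; exact zero_mem _
    | add x y _ _ hx hy => rw [lie_add]; exact add_mem hx hy
    | smul c x _ hx => rw [lie_smul]; exact Submodule.smul_mem _ c hx
    | mem x hx =>
      obtain ⟨b, hb, rfl⟩ := hx
      rw [Set.mem_ofPred_eq, Index.ord_eq, Order.add_one_le_iff] at ha hb
      exact hbasis a b ha hb

/-- If ν < ν', two ideals B and B' of Q commute when computed through g, whereas computed through f
they contain elements whose bracket sits at position ν, outside the kernel. -/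
theorem le_of_surjective [CharZero K] {Q : Type*} [LieRing Q] [LieAlgebra K Q] {ν ν' : Ordinal.{0}}
    (hν : ν < ω ^ s) (hν' : ν' < ω ^ s)
    {f : triangular K (s + 2) →ₗ⁅K⁆ Q} (hf : Function.Surjective f) (hfker : f.ker = idealOf K _ ν)
    {g : triangular K (s + 2) →ₗ⁅K⁆ Q} (hg : Function.Surjective g) (hgker : g.ker = idealOf K _ ν') :
    ν' ≤ ν := by
  by_contra! hlt
  -- From ω^s on, both remainders are absorbed, so the ideals of Q there have the same index under f
  -- and g.
  have habs : ∀ ν < (ω : Ordinal.{0}) ^ s, ∀ o, ω ^ s ≤ o → ν + o = o := fun ν hν o ho => by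
    rw [← opow_natCast] at hν ho
    exact add_of_omega0_opow_le hν ho
  have hpow : (ω : Ordinal.{0}) ^ s ≤ ω ^ (s + 1) := pow_le_pow_right₀ (one_lt_omega0.le) s.le_succ
  have htop : ω ^ (s + 1) + ω ^ s ≤ omegaSum 0 (s + 2) := by
    rw [← omegaSum_self_succ (s + 1), omegaSum_succ_add (by omega)]
    exact omegaSum_anti (Nat.zero_le _) _
  have hle : ∀ ν < (ω : Ordinal.{0}) ^ s, ν ≤ omegaSum 0 (s + 2) := fun ν hν =>
    hν.le.trans ((hpow.trans le_self_add).trans htop)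
  have hcorr : ∀ o, ω ^ s ≤ o → o ≤ ω ^ (s + 1) + ω ^ s → ∃ B : LieIdeal K Q,
      B.comap f = idealOf K _ o ∧ B.comap g = idealOf K _ o := by
    intro o h1 h2
    have := (exists_comap_eq (hle ν hν) (hle ν' hν') hf hfker hg hgker (o := o)
      (by rw [habs ν hν o h1]; exact h2.trans htop)).2
    rwa [habs ν hν o h1, habs ν' hν' o h1] at this
  obtain ⟨B, hBf, hBg⟩ := hcorr (ω ^ (s + 1) + ν') (hpow.trans le_self_add) (by gcongr)
  obtain ⟨B', hBf', hBg'⟩ := hcorr (ω ^ s + 1) le_self_add (by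
    gcongr
    exact Order.one_le_iff_pos.2 (pow_pos omega0_pos _))
  -- The witness at offset ν in the second last layer lies in B exactly because ν < ν'.
  obtain ⟨a, hai, hapos⟩ := Index.exists_pos_eq (n := s + 2) (i := (Fin.last s).castSucc) hν
  have hapos' : a.pos = ω ^ (s + 1) + ν := by
    rw [hapos, ← omegaSum_self_succ (s + 1)]
    rfl
  have hlast : (a.toLast hai).pos = ν := by
    rwa [Index.pos_of_i_eq hai, add_right_inj] at hapos'
  have hD : f (basisElt K a) ∈ B := by
    rw [← LieIdeal.mem_comap, hBf, basisElt_mem_idealOf, hapos']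
    gcongr
  have hE : f (basisElt K (Index.xLast s)) ∈ B' := by
    rw [← LieIdeal.mem_comap, hBf', basisElt_mem_idealOf, Index.pos_xLast]
    exact lt_add_one _
  obtain ⟨D, hDD⟩ := hg (f (basisElt K a))
  obtain ⟨E, hEE⟩ := hg (f (basisElt K (Index.xLast s)))
  rw [← hDD, ← LieIdeal.mem_comap, hBg] at hD
  rw [← hEE, ← LieIdeal.mem_comap, hBg'] at hE
  have h := lie_mem_idealOf hν' hD hE
  rw [← hgker, LieHom.mem_ker, LieHom.map_lie, hDD, hEE, ← LieHom.map_lie, lie_xLast hai,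
    ← LieHom.mem_ker, hfker, basisElt_mem_idealOf, hlast] at h
  exact lt_irrefl _ h

/-! ### Normal forms of the factors -/

theorem eq_and_eq_of_equiv [CharZero K] {ν ν' : Ordinal.{0}} (hν : ν < ω ^ (s - 2)) (hν' : ν' < ω ^ (t - 2))
    (e : (triangular K s ⧸ idealOf K s ν) ≃ₗ⁅K⁆ (triangular K t ⧸ idealOf K t ν')) :
    s = t ∧ ν = ν' := by
  have hf : Function.Surjective (e.toLieHom.comp (quotientMk (idealOf K s ν))) :=
    e.surjective.comp (quotientMk_surjective _)
  have hfker : (e.toLieHom.comp (quotientMk (idealOf K s ν))).ker = idealOf K s ν := by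
    ext D
    rw [LieHom.mem_ker, LieHom.comp_apply, ← quotientMk_eq_zero]
    exact e.toLinearEquiv.map_eq_zero_iff
  have hg := quotientMk_surjective (idealOf K t ν')
  have hgker : (quotientMk (idealOf K t ν')).ker = idealOf K t ν' := by
    ext D
    rw [LieHom.mem_ker, ← quotientMk_eq_zero]
  obtain rfl := eq_of_surjective hν hν' hf hfker hg hgker
  refine ⟨rfl, ?_⟩
  rcases lt_or_ge s 2 with hs | hs
  · rw [Nat.sub_eq_zero_of_le hs.le, pow_zero, Order.lt_one_iff] at hν hν'
    rw [hν, hν']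
  · obtain ⟨s, rfl⟩ := Nat.exists_eq_add_of_le' hs
    exact le_antisymm (le_of_surjective hν' hν hg hgker hf hfker)
      (le_of_surjective hν hν' hf hfker hg hgker)

/-- Restriction to t variables followed by i derivatives of the last component. Below two variables
there is no second last variable, hence i = 0. -/
theorem nonempty_equiv [CharZero K] {i : ℕ} (htn : t ≤ n) (hi : t < 2 → i = 0) (ν : Ordinal.{0}) :
    Nonempty ((triangular K n ⧸ idealOf K n (omegaSum t n + ω ^ (t - 2) * i + ν)) ≃ₗ⁅K⁆
      (triangular K t ⧸ idealOf K t ν)) := by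
  rcases lt_or_ge t 2 with ht | ht
  · rw [hi ht, Nat.cast_zero, mul_zero, add_zero]
    exact (isShift_restrict htn).nonempty_equiv ν
  · obtain ⟨t, rfl⟩ := Nat.exists_eq_add_of_le' ht
    obtain ⟨f, hf⟩ := exists_isShift_natCast_mul (K := K) (s := t) i
    exact ((isShift_restrict htn).comp hf).nonempty_equiv ν

theorem exists_normal_form {l : Ordinal.{0}} (hl : l ≤ omegaSum 0 n) :
    ∃ (t i : ℕ) (ν : Ordinal.{0}), t ≤ n ∧ (t < 2 → i = 0) ∧ ν < ω ^ (t - 2) ∧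
      l = omegaSum t n + ω ^ (t - 2) * i + ν := by
  rcases hl.eq_or_lt with rfl | hl
  -- The whole algebra is the ideal, and the factor is the zero algebra in no variables.
  · exact ⟨0, 0, 0, Nat.zero_le _, fun _ => rfl, pow_pos omega0_pos _, by simp⟩
  · obtain ⟨t, ht, r, hr, rfl⟩ := exists_eq_omegaSum_add hl
    rcases t with _ | t
    · rw [pow_zero, Order.lt_one_iff] at hr
      exact ⟨1, 0, 0, ht, fun _ => rfl, pow_pos omega0_pos _, by simp [hr]⟩
    · obtain ⟨i, ν, hν, rfl⟩ := exists_eq_opow_mul_add hr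
      exact ⟨t + 2, i, ν, ht, fun h => absurd h (by omega), hν, by rw [← add_assoc]; rfl⟩

end TriangularLie

end

open TriangularLie

theorem mainTheorem3 (K : Type*) [Field K] [CharZero K] (n m : ℕ) (hn : 2 ≤ n) (hnm : n < m)
    (I : LieIdeal K (TriangularLie.triangular K n)) (J : LieIdeal K (TriangularLie.triangular K m)) :
    Nonempty ((TriangularLie.triangular K n ⧸ I) ≃ₗ⁅K⁆ (TriangularLie.triangular K m ⧸ J)) ↔
      (∃ (i j : ℕ) (ν : Ordinal.{0}), ν < Ordinal.omega0 ^ (n - 2) ∧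
        I = TriangularLie.idealOf K n (Ordinal.omega0 ^ (n - 2) * i + ν) ∧
        J = TriangularLie.idealOf K m (TriangularLie.omegaSum n m + Ordinal.omega0 ^ (n - 2) * j + ν)) ∨
      (∃ s : ℕ, 2 ≤ s ∧ s ≤ n - 1 ∧
        ∃ (i j : ℕ) (ν : Ordinal.{0}), ν < Ordinal.omega0 ^ (s - 2) ∧
          I = TriangularLie.idealOf K n (TriangularLie.omegaSum s n + Ordinal.omega0 ^ (s - 2) * i + ν) ∧
          J = TriangularLie.idealOf K m (TriangularLie.omegaSum s m + Ordinal.omega0 ^ (s - 2) * j + ν)) ∨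
      (∃ ε : Ordinal.{0}, (ε = 0 ∨ ε = 1) ∧
        I = TriangularLie.idealOf K n (TriangularLie.omegaSum 1 n + ε) ∧
        J = TriangularLie.idealOf K m (TriangularLie.omegaSum 1 m + ε)) := by
  have hone : ∀ k : ℕ, 0 < k → omegaSum 1 k + 1 = omegaSum 0 k := fun k hk => by
    simpa using omegaSum_succ_add hk
  constructor
  · rintro ⟨e⟩
    obtain ⟨l, hl, rfl⟩ := exists_eq_idealOf I
    obtain ⟨l', hl', rfl⟩ := exists_eq_idealOf J
    obtain ⟨t, i, ν, htn, hi, hν, rfl⟩ := exists_normal_form hl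
    obtain ⟨t', j, ν', htm, hj, hν', rfl⟩ := exists_normal_form hl'
    obtain ⟨e₁⟩ := nonempty_equiv (K := K) htn hi ν
    obtain ⟨e₂⟩ := nonempty_equiv (K := K) htm hj ν'
    obtain ⟨rfl, rfl⟩ := eq_and_eq_of_equiv hν hν' ((e₁.symm.trans e).trans e₂)
    rcases lt_or_ge t 2 with ht | ht
    · right
      right
      rw [hi ht, hj ht]
      rw [Nat.sub_eq_zero_of_le ht.le, pow_zero, Order.lt_one_iff] at hν
      subst hν
      simp only [Nat.cast_zero, mul_zero, add_zero]
      -- The case t = 0 is ε = 1 (zero factor), and t = 1 is ε = 0 (one-dimensional factor).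
      interval_cases t
      · exact ⟨1, Or.inr rfl, by rw [hone n (by omega)], by rw [hone m (by omega)]⟩
      · exact ⟨0, Or.inl rfl, by rw [add_zero], by rw [add_zero]⟩
    · rcases htn.eq_or_lt with rfl | htn
      · exact Or.inl ⟨i, j, ν, hν, by rw [omegaSum_eq_zero le_rfl, zero_add], rfl⟩
      · exact Or.inr (Or.inl ⟨t, ht, by omega, i, j, ν, hν, rfl, rfl⟩)
  · have key : ∀ (t i j : ℕ) (ν l l' : Ordinal.{0}), t ≤ n → (t < 2 → i = 0 ∧ j = 0) →
        l = omegaSum t n + Ordinal.omega0 ^ (t - 2) * i + ν →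
        l' = omegaSum t m + Ordinal.omega0 ^ (t - 2) * j + ν →
        Nonempty ((triangular K n ⧸ idealOf K n l) ≃ₗ⁅K⁆ (triangular K m ⧸ idealOf K m l')) := by
      rintro t i j ν _ _ htn hij rfl rfl
      obtain ⟨e₁⟩ := nonempty_equiv (K := K) htn (fun h => (hij h).1) ν
      obtain ⟨e₂⟩ := nonempty_equiv (K := K) (htn.trans hnm.le) (fun h => (hij h).2) ν
      exact ⟨e₁.trans e₂.symm⟩
    rintro (⟨i, j, ν, -, rfl, rfl⟩ | ⟨s, hs, hsn, i, j, ν, -, rfl, rfl⟩ | ⟨ε, rfl | rfl, rfl, rfl⟩)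
    · exact key n i j ν _ _ le_rfl (by omega) (by rw [omegaSum_eq_zero le_rfl, zero_add]) rfl
    · exact key s i j ν _ _ (by omega) (by omega) rfl rfl
    · exact key 1 0 0 0 _ _ (by omega) (by omega) (by simp) (by simp)
    · exact key 0 0 0 0 _ _ (by omega) (by omega) (by simp [hone n (by omega)])
        (by simp [hone m (by omega)])
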